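/- Let $\mathcal P$ be a symmetric monoidal additive theory: a preadditive category with all small coproducts, bounded (for some regular cardinal $\kappa$ there is an essentially small full subcategory $\mathcal P_0$, closed under $\kappa$-small coproducts, such that any map from an object of $\mathcal P_0$ to a small coproduct factors through a $\kappa$-small subcoproduct, and every object of $\mathcal P$ is a retract of a small coproduct of objects of $\mathcal P_0$), whose category $\mathrm{LMod}_{\mathcal P}$ of $\mathcal P$-modules, i.e. of set-valued presheaves on $\mathcal P$ that send small coproducts to products, carries a symmetric monoidal structure $(\otimes,\mathbb 1)$ that preserves small colimits in each variable and under which the representables (identified with $\mathcal P$) are closed. Let $\mathrm{CRing}_{\mathcal P}$ be the category of commutative monoids in $\mathrm{LMod}_{\mathcal P}$. A $\mathcal P$-plethory $\Lambda$ is a colimit-preserving monad on $\mathrm{CRing}_{\mathcal P}$ or, equivalently, its right adjoint comonad $\Lambda^\vee$; $\Lambda$-rings are the algebras of $\Lambda$, i.e. the coalgebras of $\Lambda^\vee$, and morphisms $\Lambda\to\Lambda'$ are morphisms of comonads $\Lambda'^\vee\to\Lambda^\vee$. A $\mathcal P$-cobialgebroid $G$ is a colimit-preserving monad on $\mathrm{LMod}_{\mathcal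 P}$ with a lift of its right adjoint comonad $G^\vee$ to a comonoid in lax symmetric monoidal endofunctors (equivalently, a lift of $G$ to a monoid in oplax symmetric monoidal endofunctors, with counit $G(\mathbb 1)\to\mathbb 1$ and coproduct $G(M\otimes N)\to G(M)\otimes G(N)$); morphisms $G\to G'$ are monoidal morphisms of comonads $G'^\vee\to G^\vee$. The functor $S$ from cobialgebroids to plethories sends $G$ to the plethory $SG$ whose comonad $(SG)^\vee$ is the one induced by $G^\vee$ on commutative monoids. Let $\Lambda$ be a $\mathcal P$-plethory. For $A,Q\in\mathcal P$ let $\Gamma_{A}(Q)=\Gamma_{A,Q}$ be the set of natural additive operations $B(A)\to B(Q)$ on $\Lambda$-rings $B$, and for $A_1,\dots,A_n\in\mathcal P$ let $\Gamma_{(A_1,\dots,A_n)}(Q)$ be the set of natural multilinear operations $B(A_1)\times\cdots\times B(A_n)\to B(Q)$. Suppose that $\Lambda$ is good: the functor $\Gamma\colon\mathcal P\to\mathrm{LMod}_{\mathcal P}$, $A\mapsto\Gamma_A$, preserves small coproducts, and for all $n\ge 0$ and $A_1,\dots,A_n\in\mathcal P$ the map $\Gamma_{A_1}\otimes\cdots\otimes\Gamma_{A_n}\to\Gamma_{(A_1,\dots,A_n)}$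 given by multiplying the values of operations is an isomorphism. Then there are a $\mathcal P$-cobialgebroid $G$, an isomorphism $G|_{\mathcal P}\cong\Gamma$ of functors $\mathcal P\to\mathrm{LMod}_{\mathcal P}$, and a morphism $\sigma\colon SG\to\Lambda$ such that: 1. (The plethory structure of $\Lambda$ restricts to the cobialgebroid structure on $\Gamma$.) Under the action of $G$ on $\Lambda$-rings given by $\sigma$, the elements of $G(A)(Q)\cong\Gamma_{A,Q}$ act as the additive operations that they are. The unit and the multiplication of $G$ correspond to the identity operation and to the composition of operations, and the counit and the coproduct of $G$ describe the effect of operations on the units and on the products of $\Lambda$-rings. 2. ($\Gamma\cong\Gamma(\Lambda)$.) The pair $(G,\sigma)$ is universal: for every cobialgebroid $G'$ and every morphism $\tau\colon SG'\to\Lambda$ there is a unique morphism of cobialgebroids $f\colon G'\to G$ with $\sigma\circ S(f)=\tau$. That is, $\Gamma$, with this structure, is the value $\Gamma(\Lambda)$ at $\Lambda$ of the right adjoint of $S$, with counit $\sigma$. -/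

import Mathlib

open CategoryTheory CategoryTheory.Limits Opposite MonoidalCategory

universe u v w

noncomputable section

namespace Plethories

/-! ## Additive theories and their models -/

section Theories

variable (P : Type v) [Category.{u} P] [HasCoproducts.{u} P]

/-- A set-valued presheaf `X` on `P` is a (discrete) model of the theory `P` if, for every small
family `Q` of objects, the canonical map `X (∐ Q) → ∏ j, X (Q j)` is a bijection. -/
def isModel : ObjectProperty (Pᵒᵖ ⥤ Type u) := fun X =>
  ∀ (J : Type u) (Q : J → P),
    Function.Bijective (fun (x : X.obj (op (∐ Q))) (j : J) => X.map (Sigma.ι Q j).op x)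

/-- The category of discrete models of the theory `P`, i.e. of left `P`-modules when `P` is
additive. (For a bounded theory, models are automatically small presheaves.) -/
abbrev LMod : Type (max v (u + 1)) := (isModel P).FullSubcategory

/-- `P` is bounded: for some regular cardinal `κ` there is an (essentially) small full subcategory
`P₀`, closed under `κ`-small coproducts, whose objects are `κ`-compact with respect to coproducts
in `P`, and such that every object of `P` is a retract of a coproduct of objects of `P₀`.

In a category with zero morphisms the inclusion of a partial coproduct in a coproduct is a split
monomorphism, so that for additive `P` the map
`colim_{|F| < κ} Hom (A, ∐_F Q) → Hom (A, ∐ Q)` is always injective; the `κ`-compactness condition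
is its surjectivity. -/
def IsBounded : Prop :=
  ∃ (κ : Cardinal.{u}) (P₀ : ObjectProperty P), κ.IsRegular ∧
    ObjectProperty.EssentiallySmall.{u} P₀ ∧
    (∀ J : Type u, Cardinal.mk J < κ → P₀.IsClosedUnderColimitsOfShape (Discrete J)) ∧
    (∀ A : P, P₀ A → ∀ (J : Type u) (Q : J → P) (f : A ⟶ ∐ Q),
      ∃ F : Set J, Cardinal.mk F < κ ∧
        ∃ g : A ⟶ ∐ (fun j : F => Q j), g ≫ Sigma.desc (fun j : F => Sigma.ι Q j) = f) ∧
    (∀ A : P, ∃ (J : Type u) (Q : J → P), (∀ j, P₀ (Q j)) ∧ Nonempty (Retract A (∐ Q)))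

end Theories

namespace LMod

section

variable {P : Type v} [Category.{u} P] [HasCoproducts.{u} P]

/-- The value `X(Q)` of a model. -/
abbrev El (X : LMod P) (Q : P) : Type u := X.obj.obj (op Q)

/-- The restriction map `X(Q) → X(Q')` along `g : Q' ⟶ Q`. -/
abbrev res (X : LMod P) {Q Q' : P} (g : Q' ⟶ Q) (x : X.El Q) : X.El Q' := X.obj.map g.op x

/-- The map `X(Q) → Y(Q)` induced by a morphism of models. -/
abbrev app {X Y : LMod P} (f : X ⟶ Y) {Q : P} (x : X.El Q) : Y.El Q := f.hom.app (op Q) x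

/-- The addition on `X(Q)` for a model `X` of an additive theory: a pair of elements is an element
of `X(Q) × X(Q) = X(Q ⊕ Q)`, which is restricted along the diagonal `Q ⟶ Q ⊕ Q`. -/
def add [Preadditive P] (X : LMod P) {Q : P} (x y : X.El Q) : X.El Q :=
  X.res (Sigma.ι (fun _ : ULift.{u} Bool => Q) ⟨true⟩ +
      Sigma.ι (fun _ : ULift.{u} Bool => Q) ⟨false⟩)
    ((Equiv.ofBijective _ (X.property (ULift.{u} Bool) (fun _ => Q))).symm
      (fun j => if j.down then x else y))

end

variable (P : Type v) [Category.{u} P] [HasCoproducts.{u} P]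

/-- The Yoneda embedding of a theory in its category of models. -/
def yoneda : P ⥤ LMod P :=
  (isModel P).lift CategoryTheory.yoneda (by
    intro A J Q
    constructor
    · intro f g h
      refine Sigma.hom_ext _ _ fun j => ?_
      simpa using congrFun h j
    · intro f
      refine ⟨Sigma.desc (f := Q) (P := A) f, ?_⟩
      funext j
      simp)

variable {P}

/-- The morphism out of a representable model that corresponds to an element of a model. -/
def ofEl {X : LMod P} {A : P} (x : X.El A) : (yoneda P).obj A ⟶ X :=
  ObjectProperty.homMk (yonedaEquiv.symm x)

end LMod

/-- A symmetric monoidal structure on the category of models makes `P` a symmetric monoidal theory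
if the tensor product preserves (small) colimits in each variable and the full subcategory `P` of
the category of models is closed under finite tensor products. -/
class IsMonoidalTheory (P : Type v) [Category.{u} P] [HasCoproducts.{u} P]
    [MonoidalCategory (LMod P)] : Prop where
  preservesColimits_tensorLeft :
    ∀ M : LMod P, PreservesColimitsOfSize.{u, u} (tensorLeft M)
  preservesColimits_tensorRight :
    ∀ M : LMod P, PreservesColimitsOfSize.{u, u} (tensorRight M)
  exists_unit : ∃ E : P, Nonempty ((LMod.yoneda P).obj E ≅ 𝟙_ (LMod P))
  exists_tensor : ∀ A B : P,
    ∃ D : P, Nonempty ((LMod.yoneda P).obj D ≅ (LMod.yoneda P).obj A ⊗ (LMod.yoneda P).obj B)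

/-! ## Cobialgebroids -/

section Cobialgebroids

variable (C : Type w) [Category.{v} C] [MonoidalCategory C] [BraidedCategory C]

/-- A cobialgebroid `Γ` on a symmetric monoidal category: an algebra, i.e. a colimit-preserving
monad `Γ`, given through its right adjoint comonad `Γ^∨`, together with a lift of `Γ^∨` to a
comonoid in the category of lax symmetric monoidal endofunctors. -/
structure Cobialgebroid where
  /-- the comonad `Γ^∨` -/
  dual : Comonad C
  [isRightAdjoint : dual.toFunctor.IsRightAdjoint]
  [laxBraided : dual.toFunctor.LaxBraided]
  [isMonoidal_counit : NatTrans.IsMonoidal dual.ε]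
  [isMonoidal_comult : NatTrans.IsMonoidal dual.δ]

attribute [instance] Cobialgebroid.isRightAdjoint Cobialgebroid.laxBraided
  Cobialgebroid.isMonoidal_counit Cobialgebroid.isMonoidal_comult

namespace Cobialgebroid

variable {C}

/-- A morphism `Γ → Γ'` of cobialgebroids: a morphism of monads `Γ → Γ'`, equivalently of comonads
`Γ'^∨ → Γ^∨`, that is compatible with the monoidal structures. -/
@[ext]
structure Hom (Γ Γ' : Cobialgebroid C) where
  dual : Γ'.dual ⟶ Γ.dual
  isMonoidal : NatTrans.IsMonoidal dual.toNatTrans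

attribute [instance] Hom.isMonoidal

instance : Category (Cobialgebroid C) where
  Hom := Hom
  id Γ := ⟨𝟙 _, NatTrans.IsMonoidal.id⟩
  comp f g := ⟨g.dual ≫ f.dual, NatTrans.IsMonoidal.comp g.dual.toNatTrans f.dual.toNatTrans⟩

/-- The underlying colimit-preserving endofunctor `Γ` of a cobialgebroid. -/
def functor (Γ : Cobialgebroid C) : C ⥤ C := Γ.dual.toFunctor.leftAdjoint

/-- The adjunction `Γ ⊣ Γ^∨`. -/
def adj (Γ : Cobialgebroid C) : Γ.functor ⊣ Γ.dual.toFunctor :=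
  Adjunction.ofIsRightAdjoint _

/-- The unit `M ⟶ Γ(M)` of the monad `Γ` that corresponds to the comonad `Γ^∨`. -/
def unit (Γ : Cobialgebroid C) (M : C) : M ⟶ Γ.functor.obj M :=
  Γ.adj.unit.app M ≫ Γ.dual.ε.app (Γ.functor.obj M)

/-- The multiplication `Γ(Γ(M)) ⟶ Γ(M)` of the monad `Γ` that corresponds to the comonad `Γ^∨`. -/
def mul (Γ : Cobialgebroid C) (M : C) : Γ.functor.obj (Γ.functor.obj M) ⟶ Γ.functor.obj M :=
  (Γ.adj.homEquiv _ _).symm ((Γ.adj.homEquiv _ _).symm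
    (Γ.adj.unit.app M ≫ Γ.dual.δ.app (Γ.functor.obj M)))

/-- The counit `Γ(𝟙) ⟶ 𝟙` of the oplax monoidal functor `Γ`. -/
def counit (Γ : Cobialgebroid C) : Γ.functor.obj (𝟙_ C) ⟶ 𝟙_ C :=
  letI := Γ.adj.leftAdjointOplaxMonoidal
  Functor.OplaxMonoidal.η Γ.functor

/-- The coproduct `Γ(M ⊗ N) ⟶ Γ(M) ⊗ Γ(N)` of the oplax monoidal functor `Γ`. -/
def coproduct (Γ : Cobialgebroid C) (M N : C) :
    Γ.functor.obj (M ⊗ N) ⟶ Γ.functor.obj M ⊗ Γ.functor.obj N :=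
  letI := Γ.adj.leftAdjointOplaxMonoidal
  Functor.OplaxMonoidal.δ Γ.functor M N

/-- The comonad `(SΓ)^∨` on commutative monoids: as `Γ^∨` is a comonoid in lax symmetric monoidal
functors, it passes to commutative monoids. -/
def ringComonad (Γ : Cobialgebroid C) : Comonad (CommMon C) where
  toFunctor := Γ.dual.toFunctor.mapCommMon
  ε := Functor.mapCommMonNatTrans Γ.dual.ε ≫ Functor.mapCommMonIdIso.hom
  δ := Functor.mapCommMonNatTrans Γ.dual.δ ≫ Functor.mapCommMonCompIso.hom
  coassoc X := by
    refine CommMon.hom_ext _ _ ?_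
    change (Γ.dual.δ.app X.X ≫ 𝟙 (Γ.dual.obj (Γ.dual.obj X.X))) ≫
        Γ.dual.map (Γ.dual.δ.app X.X ≫ 𝟙 (Γ.dual.obj (Γ.dual.obj X.X))) =
      (Γ.dual.δ.app X.X ≫ 𝟙 (Γ.dual.obj (Γ.dual.obj X.X))) ≫ Γ.dual.δ.app (Γ.dual.obj X.X) ≫
        𝟙 (Γ.dual.obj (Γ.dual.obj (Γ.dual.obj X.X)))
    simp only [Functor.comp_obj, Category.comp_id]
    exact Γ.dual.coassoc X.X
  left_counit X := by
    refine CommMon.hom_ext _ _ ?_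
    change (Γ.dual.δ.app X.X ≫ 𝟙 (Γ.dual.obj (Γ.dual.obj X.X))) ≫
      Γ.dual.ε.app (Γ.dual.obj X.X) ≫ 𝟙 (Γ.dual.obj X.X) = 𝟙 (Γ.dual.obj X.X)
    simp only [Functor.comp_obj, Functor.id_obj, Category.comp_id]
    exact Γ.dual.left_counit X.X
  right_counit X := by
    refine CommMon.hom_ext _ _ ?_
    change (Γ.dual.δ.app X.X ≫ 𝟙 (Γ.dual.obj (Γ.dual.obj X.X))) ≫
      Γ.dual.map (Γ.dual.ε.app X.X ≫ 𝟙 X.X) = 𝟙 (Γ.dual.obj X.X)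
    simp only [Functor.comp_obj, Functor.id_obj, Category.comp_id]
    exact Γ.dual.right_counit X.X

end Cobialgebroid

/-- The functor `S`, sending a cobialgebroid `Γ` to the algebra `SΓ` over the theory of commutative
monoids, encoded by its comonad `(SΓ)^∨`. (Algebras `F`, as monads, are contravariantly the same as
the comonads `F^∨`. For models of a symmetric monoidal additive theory `P` these algebras are
`P`-plethories, which form a full subcategory of `(Comonad (CommMon C))ᵒᵖ`, so that morphisms of
plethories out of `SΓ` are morphisms in this category.) -/
def freePlethory : Cobialgebroid C ⥤ (Comonad (CommMon C))ᵒᵖ where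
  obj Γ := op Γ.ringComonad
  map {Γ Γ'} f := Quiver.Hom.op
    ({ toNatTrans := Functor.mapCommMonNatTrans f.dual.toNatTrans
       app_ε := fun X => by
         refine CommMon.hom_ext _ _ ?_
         change f.dual.app X.X ≫ Γ.dual.ε.app X.X ≫ 𝟙 X.X = Γ'.dual.ε.app X.X ≫ 𝟙 X.X
         simp only [Functor.id_obj, Category.comp_id]
         exact f.dual.app_ε X.X
       app_δ := fun X => by
         refine CommMon.hom_ext _ _ ?_
         change f.dual.app X.X ≫ Γ.dual.δ.app X.X ≫ 𝟙 (Γ.dual.obj (Γ.dual.obj X.X)) =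
           (Γ'.dual.δ.app X.X ≫ 𝟙 (Γ'.dual.obj (Γ'.dual.obj X.X))) ≫
             f.dual.app (Γ'.dual.obj X.X) ≫ Γ.dual.map (f.dual.app X.X)
         simp only [Functor.comp_obj, Category.comp_id]
         exact f.dual.app_δ X.X } :
      ComonadHom Γ'.ringComonad Γ.ringComonad)
  map_id Γ := rfl
  map_comp f g := rfl

end Cobialgebroids

/-! ## Plethories and their operations -/

/-- An algebra `T` over the theory of `P`-rings (commutative monoids in `P`-modules), given by its
comonad `T^∨`, is a `P`-plethory if `T^∨` is a right adjoint, i.e. if `T` is given by a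
colimit-preserving monad. -/
def isPlethory (P : Type v) [Category.{u} P] [HasCoproducts.{u} P]
    [MonoidalCategory (LMod P)] [BraidedCategory (LMod P)] :
    ObjectProperty (Comonad (CommMon (LMod P)))ᵒᵖ :=
  fun T => T.unop.toFunctor.IsRightAdjoint

/-- The category of `P`-plethories. -/
abbrev Plethory (P : Type v) [Category.{u} P] [HasCoproducts.{u} P]
    [MonoidalCategory (LMod P)] [BraidedCategory (LMod P)] :=
  (isPlethory P).FullSubcategory

section Operations

variable {P : Type v} [Category.{u} P] [HasCoproducts.{u} P]
  [MonoidalCategory (LMod P)] [BraidedCategory (LMod P)]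

namespace Plethory

/-- The category of `Λ`-rings: coalgebras for the comonad `Λ^∨`, which are the same as algebras for
the monad `Λ`. -/
abbrev Ring (Λ : Plethory P) := Λ.obj.unop.Coalgebra

variable {Λ : Plethory P}

/-- The `P`-module underlying a `Λ`-ring. -/
abbrev Ring.toLMod (B : Ring Λ) : LMod P := B.A.X

/-- The map of `P`-modules underlying a map of `Λ`-rings. -/
abbrev Ring.mapLMod {B B' : Ring Λ} (f : B ⟶ B') : B.toLMod ⟶ B'.toLMod := f.f.hom.hom

end Plethory

variable [Preadditive P]

open Plethory

/-- The additive natural operations `ev_A ⟶ ev_Q` on `Λ`-rings. -/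
@[ext]
structure AdditiveOperation (Λ : Plethory P) (A Q : P) where
  toFun : ∀ B : Ring Λ, B.toLMod.El A → B.toLMod.El Q
  naturality : ∀ {B B' : Ring Λ} (f : B ⟶ B') (b : B.toLMod.El A),
    toFun B' (LMod.app (Ring.mapLMod f) b) = LMod.app (Ring.mapLMod f) (toFun B b)
  map_add : ∀ (B : Ring Λ) (b b' : B.toLMod.El A),
    toFun B (B.toLMod.add b b') = B.toLMod.add (toFun B b) (toFun B b')

/-- The multilinear natural operations `ev_{A 0} × ⋯ × ev_{A (n-1)} ⟶ ev_Q` on `Λ`-rings. -/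
@[ext]
structure MultilinearOperation (Λ : Plethory P) {n : ℕ} (A : Fin n → P) (Q : P) where
  toFun : ∀ B : Ring Λ, (∀ i, B.toLMod.El (A i)) → B.toLMod.El Q
  naturality : ∀ {B B' : Ring Λ} (f : B ⟶ B') (b : ∀ i, B.toLMod.El (A i)),
    toFun B' (fun i => LMod.app (Ring.mapLMod f) (b i)) = LMod.app (Ring.mapLMod f) (toFun B b)
  map_add : ∀ (B : Ring Λ) (b : ∀ i, B.toLMod.El (A i)) (i : Fin n) (x y : B.toLMod.El (A i)),
    toFun B (Function.update b i (B.toLMod.add x y)) =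
      B.toLMod.add (toFun B (Function.update b i x)) (toFun B (Function.update b i y))

/-- The two-variable functor `Γ_{A,Q}` of additive operations `ev_A ⟶ ev_Q` on `Λ`-rings, as a
functor `A ↦ Γ_A` from `P` to `P`-modules. This is determined up to unique isomorphism by `Λ`.
(The bijection `op` only serves to replace the large type of natural transformations, which has a
small set of elements by the Yoneda lemma, by a small one.) -/
structure AdditiveOperations (Λ : Plethory P) where
  /-- the functor `A ↦ Γ_A` -/
  functor : P ⥤ LMod P
  /-- the elements of `Γ_A(Q)` are the additive operations `ev_A ⟶ ev_Q` -/
  op : ∀ {A Q : P}, (functor.obj A).El Q ≃ AdditiveOperation Λ A Q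
  /-- covariance in `A` is precomposition with the restriction `ev_{A'} ⟶ ev_A` -/
  op_map : ∀ {A A' Q : P} (g : A ⟶ A') (x : (functor.obj A).El Q) (B : Ring Λ)
    (b : B.toLMod.El A'),
    (op (LMod.app (functor.map g) x)).toFun B b = (op x).toFun B (B.toLMod.res g b)
  /-- contravariance in `Q` is postcomposition with the restriction `ev_Q ⟶ ev_{Q'}` -/
  op_res : ∀ {A Q Q' : P} (g : Q' ⟶ Q) (x : (functor.obj A).El Q) (B : Ring Λ)
    (b : B.toLMod.El A),
    (op ((functor.obj A).res g x)).toFun B b = B.toLMod.res g ((op x).toFun B b)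

/-- The tensor product `X 0 ⊗ (X 1 ⊗ ⋯ (X (n-1) ⊗ 𝟙))` of a finite family of objects. -/
def finTensor {C : Type w} [Category.{v} C] [MonoidalCategory C] :
    ∀ {n : ℕ}, (Fin n → C) → C
  | 0, _ => 𝟙_ C
  | _ + 1, X => X 0 ⊗ finTensor (fun i => X i.succ)

/-- The product `X 0 ⊗ ⋯ ⊗ X (n-1) ⟶ R` of a finite family of maps `X i ⟶ R` to a monoid. -/
def finProd {C : Type w} [Category.{v} C] [MonoidalCategory C] (R : C) [MonObj R] :
    ∀ {n : ℕ} (X : Fin n → C), (∀ i, X i ⟶ R) → (finTensor X ⟶ R)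
  | 0, _, _ => MonObj.one (X := R)
  | _ + 1, X, f =>
    (f 0 ⊗ₘ finProd R (fun i => X i.succ) (fun i => f i.succ)) ≫ MonObj.mul (X := R)

namespace AdditiveOperations

variable {Λ : Plethory P} (Γ : AdditiveOperations Λ)

/-- For an element `b` of `B(A)`, the map of `P`-modules `Γ_A ⟶ B` sending an additive operation
to its value at `b`. -/
def eval {A : P} (B : Ring Λ) (b : B.toLMod.El A) : Γ.functor.obj A ⟶ B.toLMod :=
  ObjectProperty.homMk
    { app := fun Q => ↾(fun x : (Γ.functor.obj A).El Q.unop => (Γ.op x).toFun B b)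
      naturality := by
        intro Q Q' g
        ext x
        exact Γ.op_res g.unop x B b }

/-- The operation on `Λ`-rings given by an element of `Γ_{A 0} ⊗ ⋯ ⊗ Γ_{A (n-1)}`. For operations
`x i` in `Γ_{A i}`, the element `x 0 ⊗ ⋯ ⊗ x (n-1)` gives the product of the `(x i) (b i)`. -/
def tensorOp {n : ℕ} (A : Fin n → P) {Q : P}
    (x : (finTensor fun i => Γ.functor.obj (A i)).El Q)
    (B : Ring Λ) (b : ∀ i, B.toLMod.El (A i)) : B.toLMod.El Q :=
  LMod.app (finProd B.toLMod _ fun i => Γ.eval B (b i)) x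

/-- `Λ` is good: the additive operations form a `P`-bimodule, i.e. `A ↦ Γ_A` preserves coproducts,
and the map from `Γ_{A 0} ⊗ ⋯ ⊗ Γ_{A (n-1)}` to the multilinear operations
`ev_{A 0} × ⋯ × ev_{A (n-1)} ⟶ ev` is an isomorphism for every finite family of objects of `P`. -/
structure IsGood : Prop where
  bimodule : ∀ J : Type u, PreservesColimitsOfShape (Discrete J) Γ.functor
  multilinear : ∀ (n : ℕ) (A : Fin n → P) (Q : P) (φ : MultilinearOperation Λ A Q),
    ∃! x : (finTensor fun i => Γ.functor.obj (A i)).El Q, Γ.tensorOp A x = φ.toFun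

end AdditiveOperations

/-- If `σ : SG ⟶ Λ` is a morphism of plethories, then `G` acts on `Λ`-rings: this is the map
`G(M) ⟶ B` induced by a map `m : M ⟶ B` to (the module underlying) a `Λ`-ring `B`. -/
def action {Λ : Plethory P} {G : Cobialgebroid (LMod P)}
    (σ : (freePlethory (LMod P)).obj G ⟶ Λ.obj) (B : Ring Λ) {M : LMod P} (m : M ⟶ B.toLMod) :
    G.functor.obj M ⟶ B.toLMod :=
  (G.adj.homEquiv M B.A.X).symm (m ≫ B.a.hom.hom ≫ (σ.unop.app B.A).hom.hom)

/-- A cobialgebroid `G` whose underlying functor restricts to `Γ` on `P`, and a morphism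
`σ : SG ⟶ Λ`, realize the restriction to `Γ` of the structure of the plethory `Λ`: elements of
`G(A) = Γ_A` act on `Λ`-rings as the additive operations that they are, the unit and the
multiplication of `G` are the identity operation and the composition of operations, and the counit
and the coproduct describe the effect of operations on the unit and on products of `Λ`-rings. -/
structure IsRestriction {Λ : Plethory P} (Γ : AdditiveOperations Λ) (G : Cobialgebroid (LMod P))
    (e : LMod.yoneda P ⋙ G.functor ≅ Γ.functor)
    (σ : (freePlethory (LMod P)).obj G ⟶ Λ.obj) : Prop where
  action_eq : ∀ {A Q : P} (x : (G.functor.obj ((LMod.yoneda P).obj A)).El Q) (B : Ring Λ)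
    (b : B.toLMod.El A),
    LMod.app (action σ B (LMod.ofEl b)) x = (Γ.op (LMod.app (e.hom.app A) x)).toFun B b
  unit : ∀ (B : Ring Λ) {M : LMod P} (m : M ⟶ B.toLMod), G.unit M ≫ action σ B m = m
  mul : ∀ (B : Ring Λ) {M : LMod P} (m : M ⟶ B.toLMod),
    G.mul M ≫ action σ B m = action σ B (action σ B m)
  counit : ∀ B : Ring Λ,
    action σ B (MonObj.one (X := B.toLMod)) = G.counit ≫ MonObj.one (X := B.toLMod)
  coproduct : ∀ (B : Ring Λ) {M N : LMod P} (m : M ⟶ B.toLMod) (n : N ⟶ B.toLMod),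
    action σ B ((m ⊗ₘ n) ≫ MonObj.mul (X := B.toLMod)) =
      G.coproduct M N ≫ (action σ B m ⊗ₘ action σ B n) ≫ MonObj.mul (X := B.toLMod)

end Operations

end Plethories

end

open Plethories

/-! Write $D(M)(A)=\mathrm{Hom}(\Gamma_A,M)$. Because $A\mapsto\Gamma_A$ preserves coproducts, $D$
takes values in models. It has a left adjoint, since $\Gamma_A$ is the required value on the
representable of $A$ and every model is a coequalizer of representables. Every $\Lambda$-ring $B$
carries a coaction $B\to D(B)$, `coact`, sending $b$ to evaluation of operations at $b$.

The crux is that $D$ is universal for such coactions: for a right adjoint $H$, transformations $D\to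
H$ are the same as natural families of module maps $B\to H(B)$ on $\Lambda$-rings (`natTrans_ext`,
`exists_natTrans`). Indeed, by Yoneda a transformation $D\to H$ amounts to a family of maps from the
representables to $H(\Gamma_A)$, natural in $A$. If $L\dashv H$, these are maps from $L$ of the
representables to $\Gamma_A$, and a map into $\Gamma_A$ is a natural additive family of maps into
$\Lambda$-rings, by the very definition of $\Gamma_A$. Goodness supplies the same statement for
tensor products: transformations $D(M)\otimes D(N)\to H(M\otimes N)$ are natural families $B\otimes
B\to H(B)$ (`IsGood.tensor_ext`, `IsGood.exists_tensor`), and there are analogues for the unit and,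
for uniqueness only, for three factors. Only the cases $n=0,2,3$ of goodness enter.

All structure on $D$ is thereby prescribed on $\Lambda$-rings: the counit by the identity of $B$,
the comultiplication by the iterated coaction, the lax structure by requiring `coact` to be a ring
homomorphism. The axioms are equalities of transformations, so they too are checked on
$\Lambda$-rings, where they become the ring axioms of $B$.

Morphisms $SG\to\Lambda$ amount to natural coactions $B\to G^\vee B$ by ring maps satisfying the
coalgebra laws (`hom_ext_coaction`, `exists_hom_of_coaction`). Thus `coact` defines $\sigma$, and
for any $\tau\colon SG'\to\Lambda$ the coaction of $\tau$ corresponds to a unique transformation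
$D\to G'^\vee$, which is the morphism $f$. -/

noncomputable section

namespace Plethories

namespace LMod
-- Elements of models and the Yoneda lemma.
section Elements

variable {P : Type v} [Category.{u} P] [HasCoproducts.{u} P]

@[simp] lemma res_id (X : LMod P) {Q : P} (x : X.El Q) : X.res (𝟙 Q) x = x := by
  simp [res]

lemma res_res (X : LMod P) {Q Q' Q'' : P} (g : Q' ⟶ Q) (h : Q'' ⟶ Q') (x : X.El Q) :
    X.res h (X.res g x) = X.res (h ≫ g) x := by
  simp [res]

lemma app_res {X Y : LMod P} (f : X ⟶ Y) {Q Q' : P} (g : Q' ⟶ Q) (x : X.El Q) :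
    app f (X.res g x) = Y.res g (app f x) :=
  NatTrans.naturality_apply f.hom g.op x

lemma app_comp {X Y Z : LMod P} (f : X ⟶ Y) (g : Y ⟶ Z) {Q : P} (x : X.El Q) :
    app (f ≫ g) x = app g (app f x) := rfl

lemma hom_ext_app {X Y : LMod P} {f g : X ⟶ Y} (h : ∀ (Q : P) (x : X.El Q), app f x = app g x) :
    f = g := by
  ext Q x
  exact h Q.unop x

/-- A morphism of models from a natural family of maps. -/
def homOfApp {X Y : LMod P} (f : ∀ Q : P, X.El Q → Y.El Q)
    (hf : ∀ (Q Q' : P) (g : Q' ⟶ Q) (x : X.El Q), f Q' (X.res g x) = Y.res g (f Q x)) : X ⟶ Y :=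
  ObjectProperty.homMk
    { app := fun Q => ↾(f Q.unop)
      naturality := by
        intro Q Q' g
        ext x
        exact hf _ _ g.unop x }

@[simp] lemma app_homOfApp {X Y : LMod P} (f : ∀ Q : P, X.El Q → Y.El Q) (hf) {Q : P}
    (x : X.El Q) : app (homOfApp f hf) x = f Q x := rfl

lemma ext_ι (X : LMod P) {J : Type u} {Q : J → P} {x y : X.El (∐ Q)}
    (h : ∀ j, X.res (Sigma.ι Q j) x = X.res (Sigma.ι Q j) y) : x = y :=
  (X.property J Q).1 (funext h)

lemma exists_glue (X : LMod P) {J : Type u} (Q : J → P) (x : ∀ j, X.El (Q j)) :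
    ∃ z : X.El (∐ Q), ∀ j, X.res (Sigma.ι Q j) z = x j := by
  obtain ⟨z, hz⟩ := (X.property J Q).2 x
  exact ⟨z, fun j => congrFun hz j⟩

/-- A morphism of `P`, as an element of a representable model. -/
def homEl {A Q : P} (g : Q ⟶ A) : ((yoneda P).obj A).El Q := g

lemma exists_homEl {A Q : P} (x : ((yoneda P).obj A).El Q) : ∃ g : Q ⟶ A, homEl g = x := ⟨x, rfl⟩

lemma homEl_injective {A Q : P} {f g : Q ⟶ A} (h : homEl f = homEl g) : f = g := h

lemma res_homEl {A Q Q' : P} (g : Q ⟶ A) (h : Q' ⟶ Q) :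
    ((yoneda P).obj A).res h (homEl g) = homEl (h ≫ g) := rfl

lemma app_homEl {A A' Q : P} (f : A ⟶ A') (g : Q ⟶ A) :
    app ((yoneda P).map f) (homEl g) = homEl (g ≫ f) := rfl

lemma app_ofEl {X : LMod P} {A Q : P} (x : X.El A) (g : Q ⟶ A) :
    app (ofEl x) (homEl g) = X.res g x := rfl

lemma hom_ext_homEl {A : P} {X : LMod P} {f f' : (yoneda P).obj A ⟶ X}
    (h : app f (homEl (𝟙 A)) = app f' (homEl (𝟙 A))) : f = f' := by
  refine hom_ext_app fun Q x => ?_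
  obtain ⟨g, rfl⟩ := exists_homEl x
  rw [← Category.comp_id g, ← res_homEl, app_res, app_res, h]

/-- The element of a model that corresponds to a morphism out of a representable model. -/
def toEl {X : LMod P} {A : P} (x : (yoneda P).obj A ⟶ X) : X.El A :=
  app x (homEl (𝟙 A))

@[simp] lemma toEl_ofEl {X : LMod P} {A : P} (x : X.El A) : toEl (ofEl x) = x := by
  rw [toEl, app_ofEl, res_id]

@[simp] lemma ofEl_toEl {X : LMod P} {A : P} (x : (yoneda P).obj A ⟶ X) : ofEl (toEl x) = x :=
  hom_ext_homEl (by rw [app_ofEl, res_id, toEl])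

lemma ofEl_comp {X Y : LMod P} {A : P} (x : X.El A) (f : X ⟶ Y) :
    ofEl x ≫ f = ofEl (app f x) :=
  hom_ext_homEl (by rw [app_comp, app_ofEl, app_ofEl, app_res])

lemma map_comp_ofEl {X : LMod P} {A A' : P} (g : A' ⟶ A) (x : X.El A) :
    (yoneda P).map g ≫ ofEl x = ofEl (X.res g x) :=
  hom_ext_homEl (by rw [app_comp, app_homEl, app_ofEl, app_ofEl, Category.id_comp, res_id])

lemma toEl_map_comp {X : LMod P} {A A' : P} (g : A' ⟶ A) (x : (yoneda P).obj A ⟶ X) :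
    toEl ((yoneda P).map g ≫ x) = X.res g (toEl x) := by
  rw [← ofEl_toEl x, map_comp_ofEl, toEl_ofEl, toEl_ofEl]

lemma ofEl_injective {X : LMod P} {A : P} :
    Function.Injective (ofEl : X.El A → ((yoneda P).obj A ⟶ X)) :=
  Function.LeftInverse.injective toEl_ofEl

lemma hom_ext_yoneda {X Y : LMod P} {f g : X ⟶ Y}
    (h : ∀ (A : P) (x : (yoneda P).obj A ⟶ X), x ≫ f = x ≫ g) : f = g :=
  hom_ext_app fun Q x => ofEl_injective (by rw [← ofEl_comp, ← ofEl_comp, h])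

lemma exists_hom_of_yoneda {X Y : LMod P} (φ : ∀ A : P, ((yoneda P).obj A ⟶ X) →
    ((yoneda P).obj A ⟶ Y))
    (hφ : ∀ (A A' : P) (g : A' ⟶ A) (x : (yoneda P).obj A ⟶ X),
      φ A' ((yoneda P).map g ≫ x) = (yoneda P).map g ≫ φ A x) :
    ∃ f : X ⟶ Y, ∀ (A : P) (x : (yoneda P).obj A ⟶ X), x ≫ f = φ A x := by
  refine ⟨homOfApp (fun A x => toEl (φ A (ofEl x))) ?_, ?_⟩
  · intro Q Q' g x
    rw [← map_comp_ofEl, hφ, toEl_map_comp]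
  · intro A x
    obtain ⟨x, rfl⟩ : ∃ x', ofEl x' = x := ⟨toEl x, by simp⟩
    rw [ofEl_comp, app_homOfApp, ofEl_toEl]

/-- Three elements are glued to one over the threefold coproduct of `Q`. Identities between elements
thereby reduce to identities between morphisms of `P`. -/
lemma exists_triple (X : LMod P) {Q : P} (x y z : X.El Q) :
    ∃ (R : P) (f g h : Q ⟶ R) (t : X.El R), X.res f t = x ∧ X.res g t = y ∧ X.res h t = z := by
  obtain ⟨t, ht⟩ := exists_glue X (fun _ : ULift.{u} (Fin 3) => Q) (fun j => ![x, y, z] j.down)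
  exact ⟨_, _, _, _, t, ht ⟨0⟩, ht ⟨1⟩, ht ⟨2⟩⟩

lemma exists_pair (X : LMod P) {Q : P} (x y : X.El Q) :
    ∃ (R : P) (f g : Q ⟶ R) (t : X.El R), X.res f t = x ∧ X.res g t = y := by
  obtain ⟨R, f, g, _, t, hf, hg, _⟩ := X.exists_triple x y y
  exact ⟨R, f, g, t, hf, hg⟩

end Elements

/-! ### Models of an additive theory form a preadditive category. -/

section Additive

variable {P : Type v} [Category.{u} P] [HasCoproducts.{u} P] [Preadditive P]

/-- The glued pair that defines the sum is itself a restriction of `x`, along the map out of the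
coproduct with components `f` and `g`. This transfers the group laws from the hom groups of `P`. -/
lemma add_res_res (X : LMod P) {Q Q' : P} (f g : Q' ⟶ Q) (x : X.El Q) :
    X.add (X.res f x) (X.res g x) = X.res (f + g) x := by
  have h : (Equiv.ofBijective _ (X.property (ULift.{u} Bool) (fun _ => Q'))).symm
      (fun j => if j.down then X.res f x else X.res g x) =
      X.res (Sigma.desc (fun j : ULift.{u} Bool => if j.down then f else g)) x := by
    rw [Equiv.symm_apply_eq]
    funext j
    change _ = X.res _ (X.res _ _)
    rw [res_res, Sigma.ι_desc]
    split_ifs <;> rfl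
  rw [add, h, res_res, Preadditive.add_comp, Sigma.ι_desc, Sigma.ι_desc]
  rfl

/-- The zero element of a model of an additive theory. -/
def zero (X : LMod P) (Q : P) : X.El Q :=
  X.res (0 : Q ⟶ ∐ (PEmpty.elim : PEmpty.{u+1} → P))
    (exists_glue X (PEmpty.elim : PEmpty.{u+1} → P) (fun j => j.elim)).choose

lemma res_zero_hom (X : LMod P) {Q Q' : P} (x : X.El Q) :
    X.res (0 : Q' ⟶ Q) x = X.zero Q' := by
  -- A model has exactly one element over the empty coproduct.
  have : X.res (Sigma.desc (fun j => j.elim) : ∐ (PEmpty.elim : PEmpty.{u+1} → P) ⟶ Q) x =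
      (exists_glue X (PEmpty.elim : PEmpty.{u+1} → P) (fun j => j.elim)).choose :=
    ext_ι X (fun j => j.elim)
  rw [zero, ← this, res_res, zero_comp]

instance elAdd (X : LMod P) (Q : P) : Add (X.El Q) := ⟨X.add⟩

instance elZero (X : LMod P) (Q : P) : Zero (X.El Q) := ⟨X.zero Q⟩

instance elNeg (X : LMod P) (Q : P) : Neg (X.El Q) := ⟨X.res (-𝟙 Q)⟩

/-- The values of a model of an additive theory are abelian groups. -/
instance addCommGroup (X : LMod P) (Q : P) : AddCommGroup (X.El Q) :=
  { nsmul := nsmulRec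
    zsmul := zsmulRec
    add_assoc := by
      intro a b c
      obtain ⟨R, f, g, h, t, rfl, rfl, rfl⟩ := X.exists_triple a b c
      change X.add (X.add _ _) _ = X.add _ (X.add _ _)
      simp only [add_res_res, add_assoc]
    zero_add := by
      intro a
      change X.add (X.zero Q) _ = _
      rw [← X.res_zero_hom a]
      conv_lhs => rw [← X.res_id a]
      conv_rhs => rw [← X.res_id a]
      rw [res_res, add_res_res]
      simp
    add_zero := by
      intro a
      change X.add _ (X.zero Q) = _
      rw [← X.res_zero_hom a]
      conv_lhs => rw [← X.res_id a]
      conv_rhs => rw [← X.res_id a]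
      rw [res_res, add_res_res]
      simp
    neg_add_cancel := by
      intro a
      change X.add (X.res _ a) a = X.zero Q
      conv_lhs => arg 3; rw [← X.res_id a]
      rw [add_res_res, neg_add_cancel, res_zero_hom]
    add_comm := by
      intro a b
      obtain ⟨R, f, g, t, rfl, rfl⟩ := X.exists_pair a b
      change X.add _ _ = X.add _ _
      simp only [add_res_res, add_comm] }

lemma add_eq (X : LMod P) {Q : P} (x y : X.El Q) : X.add x y = x + y := rfl

lemma res_add_hom (X : LMod P) {Q Q' : P} (f g : Q' ⟶ Q) (x : X.El Q) :
    X.res (f + g) x = X.res f x + X.res g x := (add_res_res X f g x).symm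

lemma res_add (X : LMod P) {Q Q' : P} (f : Q' ⟶ Q) (x y : X.El Q) :
    X.res f (x + y) = X.res f x + X.res f y := by
  obtain ⟨R, a, b, t, rfl, rfl⟩ := X.exists_pair x y
  rw [← res_add_hom, res_res, res_res, res_res, Preadditive.comp_add, res_add_hom]

/-- Naturality alone gives additivity, because a sum is a restriction of a common element along a
sum of morphisms. -/
lemma app_add {X Y : LMod P} (f : X ⟶ Y) {Q : P} (x y : X.El Q) :
    app f (x + y) = app f x + app f y := by
  obtain ⟨R, a, b, t, rfl, rfl⟩ := X.exists_pair x y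
  rw [← res_add_hom, app_res, app_res, app_res, res_add_hom]

/-- Restriction, as a homomorphism of groups. -/
def resHom (X : LMod P) {Q Q' : P} (f : Q' ⟶ Q) : X.El Q →+ X.El Q' :=
  AddMonoidHom.mk' (X.res f) (X.res_add f)

/-- The action of a morphism of models on elements, as a homomorphism of groups. -/
def appHom {X Y : LMod P} (f : X ⟶ Y) (Q : P) : X.El Q →+ Y.El Q :=
  AddMonoidHom.mk' (app f) (app_add f)

/-- A morphism of models from a natural family of homomorphisms of groups. -/
def homOfAddHom {X Y : LMod P} (f : ∀ Q : P, X.El Q →+ Y.El Q)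
    (hf : ∀ (Q Q' : P) (g : Q' ⟶ Q) (x : X.El Q), f Q' (X.res g x) = Y.res g (f Q x)) : X ⟶ Y :=
  homOfApp (fun Q => f Q) hf

lemma app_res_appHom {X Y : LMod P} (f : X ⟶ Y) {Q Q' : P} (g : Q' ⟶ Q) (x : X.El Q) :
    appHom f Q' (X.res g x) = Y.res g (appHom f Q x) := app_res f g x

instance homAdd (X Y : LMod P) : Add (X ⟶ Y) where
  add f g := homOfAddHom (fun Q => appHom f Q + appHom g Q) (fun Q Q' h x => by
    simp only [AddMonoidHom.add_apply, app_res_appHom, res_add])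

instance homZero (X Y : LMod P) : Zero (X ⟶ Y) where
  zero := homOfAddHom (fun _ => 0) (fun _ _ h _ => (map_zero (Y.resHom h)).symm)

instance homNeg (X Y : LMod P) : Neg (X ⟶ Y) where
  neg f := homOfAddHom (fun Q => - appHom f Q) (fun Q Q' h x => by
    simp only [AddMonoidHom.neg_apply, app_res_appHom]
    exact (map_neg (Y.resHom h) _).symm)

lemma add_app {X Y : LMod P} (f g : X ⟶ Y) {Q : P} (x : X.El Q) :
    app (f + g) x = app f x + app g x := rfl

lemma zero_app {X Y : LMod P} {Q : P} (x : X.El Q) : app (0 : X ⟶ Y) x = 0 := rfl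

lemma neg_app {X Y : LMod P} (f : X ⟶ Y) {Q : P} (x : X.El Q) : app (-f) x = -app f x := rfl

instance homAddCommGroup (X Y : LMod P) : AddCommGroup (X ⟶ Y) where
  nsmul := nsmulRec
  zsmul := zsmulRec
  add_assoc f g h := hom_ext_app fun Q x => by simp only [add_app, add_assoc]
  zero_add f := hom_ext_app fun Q x => by simp only [add_app, zero_app, zero_add]
  add_zero f := hom_ext_app fun Q x => by simp only [add_app, zero_app, add_zero]
  neg_add_cancel f := hom_ext_app fun Q x => by
    simp only [add_app, zero_app, neg_app, neg_add_cancel]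
  add_comm f g := hom_ext_app fun Q x => by simp only [add_app, add_comm]

instance preadditive : Preadditive (LMod P) where
  homGroup := homAddCommGroup
  add_comp X Y Z f g h := hom_ext_app fun Q x => by simp only [add_app, app_comp, app_add]
  comp_add X Y Z f g h := hom_ext_app fun Q x => by simp only [add_app, app_comp]

lemma ofEl_add {X : LMod P} {A : P} (x y : X.El A) : ofEl (x + y) = ofEl x + ofEl y :=
  hom_ext_homEl (by rw [add_app, app_ofEl, app_ofEl, app_ofEl, res_add])

end Additive

end LMod

/-! ### Finite limits of models. -/

section Limits

variable (P : Type v) [Category.{u} P] [HasCoproducts.{u} P]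

/-- Limits of presheaves are pointwise, and limits commute with the products in the model condition.
-/
instance isModel_isClosedUnderLimitsOfShape (J : Type) [SmallCategory J] :
    (isModel P).IsClosedUnderLimitsOfShape J where
  limitsOfShape_le := by
    rintro X ⟨h⟩ K Q
    have hl (A : Pᵒᵖ) := (Types.isLimit_iff_bijective_sectionOfCone _).1
      ⟨isLimitOfPreserves ((evaluation _ _).obj A) h.isLimit⟩
    have hext (A : Pᵒᵖ) (x y : X.obj A)
        (hxy : ∀ j, (h.π.app j).app A x = (h.π.app j).app A y) : x = y :=
      (hl A).1 (Subtype.ext (funext hxy))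
    constructor
    · intro x y hxy
      refine hext _ _ _ fun j => (h.prop_diag_obj j K Q).1 (funext fun k => ?_)
      have := congrFun hxy k
      change (h.diag.obj j).map _ _ = (h.diag.obj j).map _ _
      rw [← NatTrans.naturality_apply, ← NatTrans.naturality_apply]
      exact congrArg _ this
    · intro x
      choose z hz using fun j => (h.prop_diag_obj j K Q).2 (fun k => (h.π.app j).app _ (x k))
      obtain ⟨y, hy⟩ := (hl (op (∐ Q))).2 ⟨z, by
        intro j j' f
        refine (h.prop_diag_obj j' K Q).1 (funext fun k => ?_)
        rw [hz, ← Cone.w (Cone.mk _ h.π) f]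
        change (h.diag.obj j').map _ ((h.diag.map f).app _ (z j)) = _
        rw [← NatTrans.naturality_apply]
        exact congrArg ((h.diag.map f).app _) (congrFun (hz j) k)⟩
      have hy' (j : J) : (h.π.app j).app _ y = z j := congrFun (congrArg Subtype.val hy) j
      refine ⟨y, funext fun k => hext _ _ _ fun j => ?_⟩
      refine (NatTrans.naturality_apply (h.π.app j) (Sigma.ι Q k).op y).trans ?_
      rw [hy']
      exact congrFun (hz j) k

instance LMod.hasLimitsOfShape (J : Type) [SmallCategory J] : HasLimitsOfShape J (LMod P) :=
  hasLimitsOfShape_of_closedUnderLimits J (isModel P)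

instance LMod.hasFiniteLimits : HasFiniteLimits (LMod P) where
  out _ _ _ := inferInstance

end Limits

/-! ### Biproducts, cokernels and coequalizers of models. -/

section Cokernels

namespace LMod
variable {P : Type v} [Category.{u} P] [HasCoproducts.{u} P] [Preadditive P]

instance hasBinaryBiproducts : HasBinaryBiproducts (LMod P) :=
  HasBinaryBiproducts.of_hasBinaryProducts

instance hasZeroObject : HasZeroObject (LMod P) :=
  hasZeroObject_of_hasTerminal_object

/-- The pointwise cokernel of a map of models. -/
def coker {X Y : LMod P} (f : X ⟶ Y) : LMod P where
  obj :=
    { obj := fun Q => Y.El Q.unop ⧸ (appHom f Q.unop).range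
      map := fun {Q Q'} g => ↾(QuotientAddGroup.map _ _ (Y.resHom g.unop) (by
        rintro _ ⟨x, rfl⟩
        exact ⟨X.res g.unop x, app_res _ _ _⟩))
      map_id := fun Q => by
        ext x
        obtain ⟨x, rfl⟩ := QuotientAddGroup.mk_surjective x
        exact congrArg QuotientAddGroup.mk (Y.res_id x)
      map_comp := fun {Q Q' Q''} g h => by
        ext x
        obtain ⟨x, rfl⟩ := QuotientAddGroup.mk_surjective x
        exact congrArg QuotientAddGroup.mk (Y.res_res g.unop h.unop x).symm }
  property := by
    intro J Q
    -- Products of abelian groups are exact, so the pointwise quotient still turns coproducts into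
    -- products. For injectivity the preimages under `f` over the summands are glued; for
    -- surjectivity the representatives are.
    constructor
    · intro x y hxy
      obtain ⟨x, rfl⟩ := QuotientAddGroup.mk_surjective x
      obtain ⟨y, rfl⟩ := QuotientAddGroup.mk_surjective y
      have h (j : J) : ∃ z : X.El (Q j), app f z =
          -Y.res (Sigma.ι Q j) x + Y.res (Sigma.ι Q j) y :=
        QuotientAddGroup.eq.1 (congrFun hxy j)
      choose z hz using h
      obtain ⟨z', hz'⟩ := X.exists_glue Q z
      refine QuotientAddGroup.eq.2 ⟨z', Y.ext_ι fun j => ?_⟩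
      refine (app_res f _ z').symm.trans ?_
      rw [hz', hz]
      refine Eq.trans ?_ (map_add (Y.resHom (Sigma.ι Q j)) (-x) y).symm
      exact congrArg (· + _) (map_neg (Y.resHom (Sigma.ι Q j)) x).symm
    · intro x
      choose y hy using fun j => QuotientAddGroup.mk_surjective (x j)
      obtain ⟨y', hy'⟩ := Y.exists_glue Q y
      refine ⟨QuotientAddGroup.mk y', funext fun j => ?_⟩
      rw [← hy]
      exact congrArg QuotientAddGroup.mk (hy' j)

/-- The projection to the cokernel. -/
def cokerπ {X Y : LMod P} (f : X ⟶ Y) : Y ⟶ coker f :=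
  homOfApp (Y := coker f) (fun Q (y : Y.El Q) => QuotientAddGroup.mk y) (fun _ _ _ _ => rfl)

lemma cokerπ_surjective {X Y : LMod P} (f : X ⟶ Y) {Q : P} (z : (coker f).El Q) :
    ∃ y : Y.El Q, app (cokerπ f) y = z :=
  QuotientAddGroup.mk_surjective z

lemma comp_cokerπ {X Y : LMod P} (f : X ⟶ Y) : f ≫ cokerπ f = 0 := by
  refine hom_ext_app fun Q x => ?_
  have h : app (cokerπ f) (app f x) = app (cokerπ f) 0 :=
    QuotientAddGroup.eq.2 ⟨-x, by
      rw [map_neg, add_zero]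
      rfl⟩
  rw [app_comp, h, zero_app]
  exact map_zero (appHom (cokerπ f) Q)

lemma exists_cokerπ_comp {X Y Z : LMod P} (f : X ⟶ Y) (g : Y ⟶ Z) (h : f ≫ g = 0) :
    ∃ k : coker f ⟶ Z, cokerπ f ≫ k = g := by
  refine ⟨homOfApp (fun Q => QuotientAddGroup.lift _ (appHom g Q) ?_) ?_, ?_⟩
  · rintro _ ⟨x, rfl⟩
    exact congrArg (fun t => app t x) h
  · intro Q Q' t z
    obtain ⟨y, rfl⟩ := cokerπ_surjective f z
    exact app_res g t y
  · exact hom_ext_app fun Q x => rfl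

omit [Preadditive P] in
lemma epi_of_surjective {X Y : LMod P} (f : X ⟶ Y)
    (hf : ∀ (Q : P) (y : Y.El Q), ∃ x, app f x = y) : Epi f where
  left_cancellation g h hgh := hom_ext_app fun Q y => by
    obtain ⟨x, rfl⟩ := hf Q y
    rw [← app_comp, hgh, app_comp]

instance {X Y : LMod P} (f : X ⟶ Y) : Epi (cokerπ f) :=
  epi_of_surjective _ fun _ => cokerπ_surjective f

/-- These allow a left adjoint defined on representables to be extended along presentations, in
`Coextension.isRightAdjoint`. -/
instance hasCoequalizers : HasCoequalizers (LMod P) :=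
  have : HasCokernels (LMod P) := ⟨fun {_ _} f => ⟨⟨_, CokernelCofork.IsColimit.ofπ' (cokerπ f)
    (comp_cokerπ f) fun k hk =>
      ⟨(exists_cokerπ_comp f k hk).choose, (exists_cokerπ_comp f k hk).choose_spec⟩⟩⟩⟩
  Preadditive.hasCoequalizers_of_hasCokernels

end LMod

end Cokernels

/-! ### Presentations of models by representables. -/

section Presentations

namespace LMod

variable {P : Type v} [Category.{u} P] [HasCoproducts.{u} P]

/-- Every map from a representable model to `X` factors through `s`. -/
def IsCover {A : P} {X : LMod P} (s : (yoneda P).obj A ⟶ X) : Prop :=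
  ∀ (Q : P) (x : (yoneda P).obj Q ⟶ X), ∃ g : Q ⟶ A, (yoneda P).map g ≫ s = x

lemma IsCover.epi {A : P} {X : LMod P} {s : (yoneda P).obj A ⟶ X} (hs : IsCover s) : Epi s where
  left_cancellation g h hgh := hom_ext_yoneda fun Q x => by
    obtain ⟨k, rfl⟩ := hs Q x
    rw [Category.assoc, hgh, Category.assoc]

/-- The generators are all elements of `X` over a small set of representatives of `P₀`, glued to one
element over the coproduct. Every element over an object of `P₀` is then a restriction of it, and
gluing and retracts extend this to all objects of `P`. -/
lemma exists_isCover (hP : IsBounded P) (X : LMod P) :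
    ∃ (A : P) (s : (yoneda P).obj A ⟶ X), IsCover s := by
  obtain ⟨κ, P₀, -, hP₀, -, -, hr⟩ := hP
  obtain ⟨R, hR, -, hPR⟩ := ObjectProperty.EssentiallySmall.exists_small_le P₀
  let R' := Shrink.{u} (Subtype R)
  let q : R' → P := fun r => ((equivShrink (Subtype R)).symm r).1
  let J := Σ r : R', X.El (q r)
  obtain ⟨s, hs⟩ := X.exists_glue (fun j : J => q j.1) (fun j => j.2)
  refine ⟨_, ofEl s, ?_⟩
  suffices h : ∀ (Q : P) (x : X.El Q), ∃ g, X.res g s = x by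
    intro Q x
    obtain ⟨g, hg⟩ := h Q (toEl x)
    exact ⟨g, by rw [map_comp_ofEl, hg, ofEl_toEl]⟩
  have h₀ (Q : P) (hQ : P₀ Q) (x : X.El Q) : ∃ g, X.res g s = x := by
    obtain ⟨Q', hQ', ⟨e⟩⟩ := hPR _ hQ
    obtain ⟨r, rfl⟩ : ∃ r, q r = Q' := ⟨equivShrink _ ⟨Q', hQ'⟩, by simp [q]⟩
    refine ⟨e.hom ≫ Sigma.ι (fun j : J => q j.1) ⟨r, X.res e.inv x⟩, ?_⟩
    rw [← res_res, hs, res_res, e.hom_inv_id, res_id]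
  intro Q x
  obtain ⟨K, Q', hQ', ⟨i⟩⟩ := hr Q
  choose g hg using fun k => h₀ (Q' k) (hQ' k) (X.res (Sigma.ι Q' k) (X.res i.r x))
  refine ⟨i.i ≫ Sigma.desc g, ?_⟩
  have : X.res (Sigma.desc g) s = X.res i.r x := X.ext_ι fun k => by
    rw [res_res, Sigma.ι_desc, hg]
  rw [← res_res, this, res_res, i.retract, res_id]

/-- A presentation of a model by representable models. -/
structure Presentation (X : LMod P) where
  /-- the object of generators -/
  gen : P
  /-- the object of relations -/
  rel : P
  /-- the map from the generators -/
  π : (yoneda P).obj gen ⟶ X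
  /-- the left hand sides of the relations -/
  fst : rel ⟶ gen
  /-- the right hand sides of the relations -/
  snd : rel ⟶ gen
  isCover : IsCover π
  condition : (yoneda P).map fst ≫ π = (yoneda P).map snd ≫ π
  exists_rel : ∀ {Q : P} (g h : Q ⟶ gen), (yoneda P).map g ≫ π = (yoneda P).map h ≫ π →
    ∃ k : Q ⟶ rel, k ≫ fst = g ∧ k ≫ snd = h

lemma map_injective {A A' : P} {f g : A ⟶ A'} (h : (yoneda P).map f = (yoneda P).map g) :
    f = g := by
  have := congrArg (fun t => app t (homEl (𝟙 A))) h
  rw [app_homEl, app_homEl, Category.id_comp, Category.id_comp] at this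
  exact homEl_injective this

instance : (yoneda P).Full where
  map_surjective {A A'} f := by
    obtain ⟨g, hg⟩ := exists_homEl (toEl f)
    exact ⟨g, hom_ext_homEl (by rw [app_homEl, Category.id_comp, hg, toEl])⟩

/-- The relations come from a cover of the kernel pair of a cover of `X`. -/
lemma nonempty_presentation (hP : IsBounded P) (X : LMod P) : Nonempty (Presentation X) := by
  obtain ⟨A₀, π, hπ⟩ := exists_isCover hP X
  obtain ⟨A₁, t, ht⟩ := exists_isCover hP (pullback π π)
  obtain ⟨f, hf⟩ := (yoneda P).map_surjective (t ≫ pullback.fst π π)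
  obtain ⟨g, hg⟩ := (yoneda P).map_surjective (t ≫ pullback.snd π π)
  refine ⟨⟨A₀, A₁, π, f, g, hπ, ?_, fun {Q} a b hab => ?_⟩⟩
  · rw [hf, hg, Category.assoc, Category.assoc, pullback.condition]
  · obtain ⟨k, hk⟩ := ht Q (pullback.lift _ _ hab)
    refine ⟨k, map_injective ?_, map_injective ?_⟩
    · rw [Functor.map_comp, hf, reassoc_of% hk, pullback.lift_fst]
    · rw [Functor.map_comp, hg, reassoc_of% hk, pullback.lift_snd]

/-- A presented model is the coequalizer of its presentation. -/
def Presentation.isColimit {X : LMod P} (p : Presentation X) :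
    IsColimit (Cofork.ofπ p.π p.condition) :=
  Cofork.IsColimit.ofExistsUnique fun s => by
    change ∃! d, p.π ≫ d = s.π
    have := p.isCover.epi
    choose g hg using p.isCover
    -- Lifts through `p.π` are unique only up to relations, which `s.π` does not see. Hence the
    -- chosen lifts `g` define a natural family.
    have key {Q : P} (a b : Q ⟶ p.gen) (h : (yoneda P).map a ≫ p.π = (yoneda P).map b ≫ p.π) :
        (yoneda P).map a ≫ s.π = (yoneda P).map b ≫ s.π := by
      obtain ⟨k, rfl, rfl⟩ := p.exists_rel a b h
      simp only [Functor.map_comp, Category.assoc, s.condition]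
    obtain ⟨d, hd⟩ := exists_hom_of_yoneda (fun A x => (yoneda P).map (g A x) ≫ s.π)
      (fun A A' t x => by
        rw [← Category.assoc, ← Functor.map_comp]
        exact key _ _ (by rw [hg, Functor.map_comp, Category.assoc, hg]))
    have hd' : p.π ≫ d = s.π := by
      rw [hd]
      refine (key _ (𝟙 _) ?_).trans ?_
      · rw [hg, CategoryTheory.Functor.map_id, Category.id_comp]
      · rw [CategoryTheory.Functor.map_id, Category.id_comp]
    exact ⟨d, hd', fun d' h => by rw [← cancel_epi p.π, hd']; exact h⟩

/-- A map out of `X` is determined by its composite with a cover, which is one element of `Y`. -/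
lemma locallySmall (hP : IsBounded P) : LocallySmall.{u} (LMod P) where
  hom_small X Y := by
    obtain ⟨A, s, hs⟩ := exists_isCover hP X
    have := hs.epi
    exact small_of_injective (β := Y.El A) (f := fun f => toEl (s ≫ f)) fun f g h => by
      rw [← cancel_epi s, ← ofEl_toEl (s ≫ f), ← ofEl_toEl (s ≫ g)]
      exact congrArg ofEl h

variable {E : Type*} [Category* E] (F : LMod P ⥤ E) [PreservesColimitsOfShape WalkingParallelPair F]

/-- With `exists_desc`, this says that `F.obj X` is the colimit of the values of `F` on the
representables over `X`. That index category may be large; a presentation reduces it to one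
coequalizer, which `F` preserves. -/
lemma hom_ext_of_preserves (hP : IsBounded P) {X : LMod P} {Z : E} {f g : F.obj X ⟶ Z}
    (h : ∀ (A : P) (x : (yoneda P).obj A ⟶ X), F.map x ≫ f = F.map x ≫ g) : f = g := by
  obtain ⟨p⟩ := nonempty_presentation hP X
  exact Cofork.IsColimit.hom_ext (isColimitCoforkMapOfIsColimit F _ p.isColimit) (h _ p.π)

lemma exists_desc (hP : IsBounded P) {X : LMod P} {Z : E}
    (c : ∀ A : P, ((yoneda P).obj A ⟶ X) → (F.obj ((yoneda P).obj A) ⟶ Z))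
    (hc : ∀ (A A' : P) (g : A' ⟶ A) (x : (yoneda P).obj A ⟶ X),
      c A' ((yoneda P).map g ≫ x) = F.map ((yoneda P).map g) ≫ c A x) :
    ∃ f : F.obj X ⟶ Z, ∀ (A : P) (x : (yoneda P).obj A ⟶ X), F.map x ≫ f = c A x := by
  obtain ⟨p⟩ := nonempty_presentation hP X
  obtain ⟨f, hf⟩ := Cofork.IsColimit.desc' (isColimitCoforkMapOfIsColimit F _ p.isColimit)
    (c _ p.π) (by rw [← hc, ← hc, p.condition])
  refine ⟨f, fun A x => ?_⟩
  obtain ⟨g, rfl⟩ := p.isCover A x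
  rw [hc, F.map_comp, Category.assoc]
  exact congrArg _ hf

end LMod
end Presentations

/-! ### The functor $\mathrm{Hom}(\Gamma,-)$ and its left adjoint. -/

section Coextension

variable {P : Type v} [Category.{u} P] [HasCoproducts.{u} P]

/-- The right adjoint `M ↦ Hom(Γ, M)` of the extension of a functor `Γ` from `P` to models. -/
structure Coextension (Γ : P ⥤ LMod P) where
  /-- the functor `M ↦ Hom(Γ, M)` -/
  functor : LMod P ⥤ LMod P
  /-- the elements of `Hom(Γ, M)` are the maps out of the values of `Γ` -/
  homEquiv : ∀ {A : P} {M : LMod P},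
    (Γ.obj A ⟶ M) ≃ ((LMod.yoneda P).obj A ⟶ functor.obj M)
  homEquiv_comp : ∀ {A : P} {M N : LMod P} (f : Γ.obj A ⟶ M) (g : M ⟶ N),
    homEquiv (f ≫ g) = homEquiv f ≫ functor.map g
  homEquiv_map_comp : ∀ {A A' : P} {M : LMod P} (g : A' ⟶ A) (f : Γ.obj A ⟶ M),
    homEquiv (Γ.map g ≫ f) = (LMod.yoneda P).map g ≫ homEquiv f

open LMod

/-- The presheaf $A\mapsto\mathrm{Hom}(\Gamma_A,M)$ is a model since `Γ` preserves coproducts;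
`shrinkYoneda` brings its values into the universe `u`. -/
lemma nonempty_coextension (hP : IsBounded P) (Γ : P ⥤ LMod P)
    [∀ J : Type u, PreservesColimitsOfShape (Discrete J) Γ] : Nonempty (Coextension Γ) := by
  have := locallySmall hP
  let F : LMod P ⥤ LMod P := (isModel P).lift
    (shrinkYoneda.{u} ⋙ (Functor.whiskeringLeft _ _ (Type u)).obj Γ.op) (by
      intro M J Q
      have hc : IsColimit (Cofan.mk (Γ.obj (∐ Q)) fun j => Γ.map (Sigma.ι Q j)) :=
        isColimitCofanMkObjOfIsColimit Γ _ _ (coproductIsCoproduct Q)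
      constructor
      · intro x y hxy
        refine shrinkYonedaObjObjEquiv.injective (Cofan.IsColimit.hom_ext hc _ _ fun j => ?_)
        have h := congrArg shrinkYonedaObjObjEquiv (congrFun hxy j)
        exact (shrinkYonedaObjObjEquiv_obj_map _ _).symm.trans
          (h.trans (shrinkYonedaObjObjEquiv_obj_map _ _))
      · intro x
        refine ⟨shrinkYonedaObjObjEquiv.symm
          (Cofan.IsColimit.desc hc fun j => shrinkYonedaObjObjEquiv (x j)), funext fun j => ?_⟩
        refine shrinkYonedaObjObjEquiv.injective ((shrinkYonedaObjObjEquiv_obj_map _ _).trans ?_)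
        rw [Equiv.apply_symm_apply]
        exact Cofan.IsColimit.fac hc _ j)
  let e (A : P) (M : LMod P) : (Γ.obj A ⟶ M) ≃ ((yoneda P).obj A ⟶ F.obj M) :=
    { toFun := fun f => ofEl (X := F.obj M) (shrinkYonedaObjObjEquiv.symm f)
      invFun := fun x => shrinkYonedaObjObjEquiv (Y := op (Γ.obj A)) (toEl x)
      left_inv := fun f =>
        (congrArg shrinkYonedaObjObjEquiv (toEl_ofEl _)).trans (Equiv.apply_symm_apply _ _)
      right_inv := fun x => by
        refine Eq.trans ?_ (ofEl_toEl x)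
        exact congrArg ofEl (Equiv.symm_apply_apply _ _) }
  refine ⟨⟨F, fun {A M} => e A M, fun {A M N} f g => ?_, fun {A A' M} g f => ?_⟩⟩
  · refine Eq.trans ?_ (ofEl_comp _ _).symm
    exact congrArg ofEl (shrinkYoneda_map_app_shrinkYonedaObjObjEquiv_symm (Y := op (Γ.obj A))
      f g).symm
  · refine Eq.trans ?_ (map_comp_ofEl _ _).symm
    exact congrArg ofEl (shrinkYonedaObjObjEquiv_symm_comp (Γ.map g) f)

namespace Coextension

variable {Γ : P ⥤ LMod P} (D : Coextension Γ)

/-- The universal element of `Hom(Γ, Γ_A)`. -/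
def univ (A : P) : (yoneda P).obj A ⟶ D.functor.obj (Γ.obj A) := D.homEquiv (𝟙 _)

lemma univ_comp_map {A : P} {M : LMod P} (f : Γ.obj A ⟶ M) :
    D.univ A ≫ D.functor.map f = D.homEquiv f := by
  rw [univ, ← homEquiv_comp, Category.id_comp]

lemma exists_univ_comp_map {A : P} {M : LMod P} (x : (yoneda P).obj A ⟶ D.functor.obj M) :
    ∃ f : Γ.obj A ⟶ M, D.univ A ≫ D.functor.map f = x :=
  ⟨D.homEquiv.symm x, by rw [univ_comp_map, Equiv.apply_symm_apply]⟩

lemma map_comp_univ {A A' : P} (g : A' ⟶ A) :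
    (yoneda P).map g ≫ D.univ A = D.univ A' ≫ D.functor.map (Γ.map g) := by
  rw [univ_comp_map, univ, ← homEquiv_map_comp, Category.comp_id]

/-- On representables the left adjoint is given by `Γ`, and the models on which it is defined are
closed under coequalizers. -/
lemma isRightAdjoint [Preadditive P] (hP : IsBounded P) : D.functor.IsRightAdjoint := by
  refine Functor.isRightAdjoint_of_leftAdjointObjIsDefined_eq_top ?_
  have hy (A : P) : D.functor.leftAdjointObjIsDefined ((yoneda P).obj A) :=
    Functor.CorepresentableBy.isCorepresentable (X := Γ.obj A)
      { homEquiv := D.homEquiv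
        homEquiv_comp := fun g f => D.homEquiv_comp f g }
  ext X
  simp only [Pi.top_apply, Prop.top_eq_true, iff_true]
  obtain ⟨p⟩ := nonempty_presentation hP X
  refine Functor.leftAdjointObjIsDefined_of_isColimit p.isColimit ?_
  rintro (_ | _)
  · exact hy _
  · exact hy _

end Coextension

end Coextension

/-! ### Adjoints and tensor products are additive. -/

section Additivity

open LMod

variable {P : Type v} [Category.{u} P] [HasCoproducts.{u} P] [Preadditive P]

lemma additive_of_isRightAdjoint (F : LMod P ⥤ LMod P) [F.IsRightAdjoint] : F.Additive :=
  F.additive_of_preserves_binary_products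

lemma additive_of_isLeftAdjoint (F : LMod P ⥤ LMod P) [F.IsLeftAdjoint] : F.Additive :=
  have := additive_of_isRightAdjoint F.rightAdjoint
  (Adjunction.ofIsLeftAdjoint F).left_adjoint_additive

lemma additive_of_preservesColimits (F : LMod P ⥤ LMod P) [PreservesColimitsOfSize.{u, u} F] :
    F.Additive := by
  have : PreservesFiniteColimits F := PreservesColimitsOfSize.preservesFiniteColimits F
  have := preservesBinaryBiproducts_of_preservesBinaryCoproducts F
  exact F.additive_of_preservesBinaryBiproducts

variable [MonoidalCategory (LMod P)] [IsMonoidalTheory P]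

instance (M : LMod P) : PreservesColimitsOfSize.{u, u} (tensorLeft M) :=
  IsMonoidalTheory.preservesColimits_tensorLeft M

instance (M : LMod P) : PreservesColimitsOfSize.{u, u} (tensorRight M) :=
  IsMonoidalTheory.preservesColimits_tensorRight M

instance (M : LMod P) : PreservesFiniteColimits (tensorLeft M) :=
  PreservesColimitsOfSize.preservesFiniteColimits (tensorLeft M)

instance (M : LMod P) : PreservesFiniteColimits (tensorRight M) :=
  PreservesColimitsOfSize.preservesFiniteColimits (tensorRight M)

/-- Tensoring with a fixed model preserves finite colimits, hence biproducts, hence sums of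
morphisms. -/
instance : MonoidalPreadditive (LMod P) where
  whiskerLeft_zero {X Y Z} := (tensorLeft X).map_zero Y Z
  zero_whiskerRight {X Y Z} := (tensorRight X).map_zero Y Z
  whiskerLeft_add {X _ _} _ _ := (additive_of_preservesColimits (tensorLeft X)).map_add
  add_whiskerRight {X _ _} _ _ := (additive_of_preservesColimits (tensorRight X)).map_add

end Additivity

/-! ### Iterated products in a monoid object. -/

section FinProd

variable {C : Type w} [Category.{v} C] [MonoidalCategory C]

lemma tensorHom_mul_comp {R S X Y : C} [MonObj R] [MonObj S] (g : R ⟶ S) [IsMonHom g]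
    (a : X ⟶ R) (b : Y ⟶ R) :
    ((a ⊗ₘ b) ≫ MonObj.mul) ≫ g = ((a ≫ g) ⊗ₘ (b ≫ g)) ≫ MonObj.mul := by
  rw [Category.assoc, IsMonHom.mul_hom, tensorHom_comp_tensorHom_assoc]

lemma finProd_comp {R S : C} [MonObj R] [MonObj S] (g : R ⟶ S) [IsMonHom g] {n : ℕ}
    (X : Fin n → C) (f : ∀ i, X i ⟶ R) : finProd R X f ≫ g = finProd S X (fun i => f i ≫ g) := by
  induction n with
  | zero => exact IsMonHom.one_hom g
  | succ n ih =>
    refine (tensorHom_mul_comp g (f 0) (finProd R _ _)).trans ?_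
    rw [ih]
    rfl

lemma finProd_update_add [Preadditive C] [MonoidalPreadditive C] (R : C) [MonObj R] {n : ℕ}
    (X : Fin n → C) (f : ∀ i, X i ⟶ R) (i : Fin n) (g h : X i ⟶ R) :
    finProd R X (Function.update f i (g + h)) =
      finProd R X (Function.update f i g) + finProd R X (Function.update f i h) := by
  induction n with
  | zero => exact i.elim0
  | succ n ih =>
    simp only [finProd]
    refine Fin.cases (fun g h => ?_) (fun i g h => ?_) i g h
    · have e (k : X 0 ⟶ R) : (fun i : Fin n => Function.update f 0 k i.succ) =
        fun i : Fin n => f i.succ := Fin.tail_update_zero f k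
      simp only [e, Function.update_self, MonoidalPreadditive.add_tensor]
      exact Preadditive.add_comp _ _ _ _ _ _
    · have e (k : X i.succ ⟶ R) : (fun j : Fin n => Function.update f i.succ k j.succ) =
        Function.update (fun j : Fin n => f j.succ) i k := Fin.tail_update_succ f i k
      have e' (k : X i.succ ⟶ R) : Function.update f i.succ k 0 = f 0 :=
        Function.update_of_ne (Fin.succ_ne_zero i).symm _ _
      simp only [e, e', ih, MonoidalPreadditive.tensor_add]
      exact Preadditive.add_comp _ _ _ _ _ _

/-- The left hand side is `finProd` for two factors. The lemma removes the trailing tensor unit that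
`finTensor` carries. -/
lemma finProd_two {R X Y : C} [MonObj R] (a : X ⟶ R) (b : Y ⟶ R) :
    (a ⊗ₘ ((b ⊗ₘ MonObj.one (X := R)) ≫ MonObj.mul)) ≫ MonObj.mul =
      (X ◁ (ρ_ Y).hom) ≫ (a ⊗ₘ b) ≫ MonObj.mul := by
  have : (b ⊗ₘ MonObj.one (X := R)) ≫ MonObj.mul = (ρ_ Y).hom ≫ b := by
    rw [MonoidalCategory.tensorHom_def, Category.assoc, MonObj.mul_one, rightUnitor_naturality]
  rw [this, ← id_tensorHom, tensorHom_comp_tensorHom_assoc, Category.id_comp]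

end FinProd

/-! ### Goodness as a description of maps into tensor products of operations. -/

section Goodness

variable {P : Type v} [Category.{u} P] [HasCoproducts.{u} P]
  [MonoidalCategory (LMod P)] [BraidedCategory (LMod P)]

open Plethory LMod

instance {Λ : Plethory P} {B B' : Ring Λ} (f : B ⟶ B') : IsMonHom (Ring.mapLMod f) :=
  inferInstanceAs (IsMonHom f.f.hom.hom)

variable [Preadditive P]

namespace AdditiveOperations

variable {Λ : Plethory P} (Γ : AdditiveOperations Λ)

lemma app_eval {A Q : P} (B : Ring Λ) (b : B.toLMod.El A) (x : (Γ.functor.obj A).El Q) :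
    app (Γ.eval B b) x = (Γ.op x).toFun B b := rfl

lemma eval_add {A : P} (B : Ring Λ) (b b' : B.toLMod.El A) :
    Γ.eval B (b + b') = Γ.eval B b + Γ.eval B b' :=
  hom_ext_app fun _ x => (Γ.op x).map_add B b b'

lemma eval_comp {A : P} {B B' : Ring Λ} (b : B.toLMod.El A) (f : B ⟶ B') :
    Γ.eval B b ≫ Ring.mapLMod f = Γ.eval B' (app (Ring.mapLMod f) b) :=
  hom_ext_app fun _ x => ((Γ.op x).naturality f b).symm

lemma map_comp_eval {A A' : P} (g : A' ⟶ A) (B : Ring Λ) (b : B.toLMod.El A) :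
    Γ.functor.map g ≫ Γ.eval B b = Γ.eval B (B.toLMod.res g b) :=
  hom_ext_app fun _ x => Γ.op_map g x B b

lemma app_finProd_eval {n : ℕ} (A : Fin n → P) {Q : P}
    (x : (finTensor fun i => Γ.functor.obj (A i)).El Q) (B : Ring Λ)
    (b : ∀ i, B.toLMod.El (A i)) :
    app (finProd B.toLMod _ fun i => Γ.eval B (b i)) x = Γ.tensorOp A x B b := rfl

variable [IsMonoidalTheory P]

/-- The multilinear operation given by an element of a tensor product of operations. -/
def multilinearOperation {n : ℕ} (A : Fin n → P) {Q : P}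
    (x : (finTensor fun i => Γ.functor.obj (A i)).El Q) : MultilinearOperation Λ A Q where
  toFun := Γ.tensorOp A x
  naturality {B B'} f b := by
    rw [← app_finProd_eval, ← app_finProd_eval, ← app_comp, finProd_comp]
    simp only [eval_comp]
  map_add B b i y z := by
    have e (k : B.toLMod.El (A i)) : (fun j => Γ.eval B (Function.update b i k j)) =
        Function.update (fun j => Γ.eval B (b j)) i (Γ.eval B k) :=
      funext fun j => Function.apply_update (fun j => Γ.eval B) b i k j
    rw [add_eq, add_eq, ← app_finProd_eval, ← app_finProd_eval, ← app_finProd_eval, e, e, e,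
      eval_add, finProd_update_add, add_app]

variable {Γ} (hΓ : Γ.IsGood)

include hΓ

/-- The uniqueness half of goodness, applied to each element of `X`. -/
lemma IsGood.hom_ext {n : ℕ} (A : Fin n → P) {X : LMod P}
    {f g : X ⟶ finTensor fun i => Γ.functor.obj (A i)}
    (h : ∀ (B : Ring Λ) (b : ∀ i, B.toLMod.El (A i)),
      f ≫ finProd B.toLMod _ (fun i => Γ.eval B (b i)) =
        g ≫ finProd B.toLMod _ (fun i => Γ.eval B (b i))) : f = g :=
  hom_ext_app fun Q x =>
    (hΓ.multilinear n A Q (Γ.multilinearOperation A (app g x))).unique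
      (funext fun B => funext fun b => congrArg (fun t => app t x) (h B b)) rfl

omit [IsMonoidalTheory P] in
-- Each element of `X` yields a multilinear operation, hence an element of the tensor product by the
-- existence half of goodness. Uniqueness makes this choice compatible with restriction.
lemma IsGood.exists_hom {n : ℕ} (A : Fin n → P) {X : LMod P}
    (φ : ∀ B : Ring Λ, (∀ i, B.toLMod.El (A i)) → (X ⟶ B.toLMod))
    (hφ : ∀ {B B' : Ring Λ} (f : B ⟶ B') (b : ∀ i, B.toLMod.El (A i)),
      φ B' (fun i => app (Ring.mapLMod f) (b i)) = φ B b ≫ Ring.mapLMod f)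
    (hφ' : ∀ (B : Ring Λ) (b : ∀ i, B.toLMod.El (A i)) (i : Fin n) (x y : B.toLMod.El (A i)),
      φ B (Function.update b i (x + y)) =
        φ B (Function.update b i x) + φ B (Function.update b i y)) :
    ∃ f : X ⟶ finTensor fun i => Γ.functor.obj (A i), ∀ (B : Ring Λ)
      (b : ∀ i, B.toLMod.El (A i)), f ≫ finProd B.toLMod _ (fun i => Γ.eval B (b i)) = φ B b := by
  choose f hf hf' using fun (Q : P) (x : X.El Q) => hΓ.multilinear n A Q
    { toFun := fun B b => app (φ B b) x
      naturality := fun f b => congrArg (fun t => app t x) (hφ f b)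
      map_add := fun B b i y z => congrArg (fun t => app t x) (hφ' B b i y z) }
  refine ⟨homOfApp f fun Q Q' g x => ?_, fun B b => hom_ext_app fun Q x =>
    congrFun (congrFun (hf Q x) B) b⟩
  refine (hf' _ _ _ (funext fun B => funext fun b => ?_)).symm
  refine (app_res (finProd B.toLMod _ fun i => Γ.eval B (b i)) g (f Q x)).trans ?_
  refine (congrArg (B.toLMod.res g) (congrFun (congrFun (hf Q x) B) b)).trans ?_
  exact (app_res (φ B b) g x).symm

end AdditiveOperations

end Goodness

/-! ### Evaluation of operations, for zero to three arguments. -/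

section Action

variable {P : Type v} [Category.{u} P] [HasCoproducts.{u} P]
  [MonoidalCategory (LMod P)] [BraidedCategory (LMod P)] [Preadditive P]

open Plethory LMod

namespace AdditiveOperations

variable {Λ : Plethory P} (Γ : AdditiveOperations Λ)

/-- For a map `b` from a representable model to a `Λ`-ring, the map from the corresponding additive
operations to the `Λ`-ring that evaluates operations at `b`. -/
def act {A : P} {B : Ring Λ} (b : (yoneda P).obj A ⟶ B.toLMod) : Γ.functor.obj A ⟶ B.toLMod :=
  Γ.eval B (toEl b)

lemma act_ofEl {A : P} {B : Ring Λ} (b : B.toLMod.El A) : Γ.act (ofEl b) = Γ.eval B b := by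
  rw [act, toEl_ofEl]

lemma act_comp {A : P} {B B' : Ring Λ} (b : (yoneda P).obj A ⟶ B.toLMod) (f : B ⟶ B') :
    Γ.act b ≫ Ring.mapLMod f = Γ.act (b ≫ Ring.mapLMod f) :=
  Γ.eval_comp _ _

lemma map_comp_act {A A' : P} (g : A' ⟶ A) {B : Ring Λ} (b : (yoneda P).obj A ⟶ B.toLMod) :
    Γ.functor.map g ≫ Γ.act b = Γ.act ((yoneda P).map g ≫ b) := by
  rw [act, map_comp_eval, act, toEl_map_comp]

lemma act_hom_ext {A : P} {X : LMod P} {f g : X ⟶ Γ.functor.obj A}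
    (h : ∀ (B : Ring Λ) (b : (yoneda P).obj A ⟶ B.toLMod), f ≫ Γ.act b = g ≫ Γ.act b) :
    f = g := by
  refine hom_ext_app fun Q x => Γ.op.injective (AdditiveOperation.ext ?_)
  funext B b
  have := congrArg (fun t => app t x) (h B (ofEl b))
  rwa [act_ofEl] at this

/-- The case of one argument needs no goodness: the elements of `Γ_A` are by definition the additive
operations. With `act_hom_ext`, maps into `Γ_A` are natural additive families of maps into
$\Lambda$-rings. -/
lemma exists_comp_act {A : P} {X : LMod P}
    (φ : ∀ B : Ring Λ, ((yoneda P).obj A ⟶ B.toLMod) → (X ⟶ B.toLMod))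
    (hφ : ∀ {B B' : Ring Λ} (f : B ⟶ B') (b : (yoneda P).obj A ⟶ B.toLMod),
      φ B' (b ≫ Ring.mapLMod f) = φ B b ≫ Ring.mapLMod f)
    (hφ' : ∀ (B : Ring Λ) (x y : (yoneda P).obj A ⟶ B.toLMod),
      φ B (x + y) = φ B x + φ B y) :
    ∃ f : X ⟶ Γ.functor.obj A, ∀ (B : Ring Λ) (b : (yoneda P).obj A ⟶ B.toLMod),
      f ≫ Γ.act b = φ B b := by
  let f (Q : P) (x : X.El Q) : (Γ.functor.obj A).El Q := Γ.op.symm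
    { toFun := fun B b => app (φ B (ofEl b)) x
      naturality := fun f b =>
        congrArg (fun t => app t x) ((congrArg (φ _) (ofEl_comp b _).symm).trans (hφ f (ofEl b)))
      map_add := fun B b b' =>
        congrArg (fun t => app t x) ((congrArg (φ B) (ofEl_add b b')).trans (hφ' B _ _)) }
  have hf (Q : P) (x : X.El Q) (B : Ring Λ) (b : B.toLMod.El A) :
      (Γ.op (f Q x)).toFun B b = app (φ B (ofEl b)) x := by
    simp only [f, Equiv.apply_symm_apply]
  refine ⟨homOfApp f fun Q Q' g x => Γ.op.injective (AdditiveOperation.ext ?_),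
    fun B b => hom_ext_app fun Q x => ?_⟩
  · funext B b
    rw [hf, op_res, hf, app_res]
  · rw [app_comp, app_homOfApp, act, app_eval, hf, ofEl_toEl]

variable [IsMonoidalTheory P] {Γ} (hΓ : Γ.IsGood)

include hΓ

lemma IsGood.hom_ext_unit {X : LMod P} {f g : X ⟶ 𝟙_ (LMod P)}
    (h : ∀ B : Ring Λ, f ≫ MonObj.one (X := B.toLMod) = g ≫ MonObj.one (X := B.toLMod)) : f = g :=
  hΓ.hom_ext (n := 0) (A := finZeroElim) fun B _ => h B

omit [IsMonoidalTheory P] in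
lemma IsGood.exists_comp_one {X : LMod P} (φ : ∀ B : Ring Λ, X ⟶ B.toLMod)
    (hφ : ∀ {B B' : Ring Λ} (f : B ⟶ B'), φ B' = φ B ≫ Ring.mapLMod f) :
    ∃ f : X ⟶ 𝟙_ (LMod P), ∀ B : Ring Λ, f ≫ MonObj.one (X := B.toLMod) = φ B := by
  obtain ⟨f, hf⟩ := hΓ.exists_hom (n := 0) (A := finZeroElim) (fun B _ => φ B)
    (fun f _ => hφ f) (fun _ _ i => i.elim0)
  exact ⟨f, fun B => hf B finZeroElim⟩

lemma IsGood.hom_ext_tensor {A A' : P} {X : LMod P}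
    {f g : X ⟶ Γ.functor.obj A ⊗ Γ.functor.obj A'}
    (h : ∀ (B : Ring Λ) (b : (yoneda P).obj A ⟶ B.toLMod) (b' : (yoneda P).obj A' ⟶ B.toLMod),
      f ≫ (Γ.act b ⊗ₘ Γ.act b') ≫ MonObj.mul = g ≫ (Γ.act b ⊗ₘ Γ.act b') ≫ MonObj.mul) :
    f = g := by
  have e : f ≫ Γ.functor.obj A ◁ (ρ_ (Γ.functor.obj A')).inv =
      g ≫ Γ.functor.obj A ◁ (ρ_ (Γ.functor.obj A')).inv := by
    have h' (t : X ⟶ Γ.functor.obj A ⊗ Γ.functor.obj A') (B : Ring Λ) (b : B.toLMod.El A)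
        (b' : B.toLMod.El A') :
        (t ≫ Γ.functor.obj A ◁ (ρ_ (Γ.functor.obj A')).inv) ≫
          (Γ.eval B b ⊗ₘ ((Γ.eval B b' ⊗ₘ MonObj.one (X := B.toLMod)) ≫
            MonObj.mul)) ≫ MonObj.mul = t ≫ (Γ.act (ofEl b) ⊗ₘ Γ.act (ofEl b')) ≫ MonObj.mul := by
      rw [finProd_two, Category.assoc, whiskerLeft_inv_hom_assoc, act_ofEl, act_ofEl]
    refine hΓ.hom_ext (n := 2) (A := ![A, A']) fun B b => ?_
    exact (h' f B (b 0) (b 1)).trans ((h B _ _).trans (h' g B (b 0) (b 1)).symm)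
  exact (cancel_mono _).1 e

/-- The case $n=3$ of goodness, with the trailing unit removed; it serves the associativity of the
lax structure. -/
lemma IsGood.hom_ext_tensor₃ {A A' A'' : P} {X : LMod P}
    {f g : X ⟶ Γ.functor.obj A ⊗ (Γ.functor.obj A' ⊗ Γ.functor.obj A'')}
    (h : ∀ (B : Ring Λ) (b : (yoneda P).obj A ⟶ B.toLMod) (b' : (yoneda P).obj A' ⟶ B.toLMod)
      (b'' : (yoneda P).obj A'' ⟶ B.toLMod),
      f ≫ (Γ.act b ⊗ₘ ((Γ.act b' ⊗ₘ Γ.act b'') ≫ MonObj.mul)) ≫ MonObj.mul =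
        g ≫ (Γ.act b ⊗ₘ ((Γ.act b' ⊗ₘ Γ.act b'') ≫ MonObj.mul)) ≫ MonObj.mul) :
    f = g := by
  have e : f ≫ Γ.functor.obj A ◁ Γ.functor.obj A' ◁ (ρ_ (Γ.functor.obj A'')).inv =
      g ≫ Γ.functor.obj A ◁ Γ.functor.obj A' ◁ (ρ_ (Γ.functor.obj A'')).inv := by
    have h' (t : X ⟶ Γ.functor.obj A ⊗ (Γ.functor.obj A' ⊗ Γ.functor.obj A'')) (B : Ring Λ)
        (b : B.toLMod.El A) (b' : B.toLMod.El A') (b'' : B.toLMod.El A'') :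
        (t ≫ Γ.functor.obj A ◁ Γ.functor.obj A' ◁ (ρ_ (Γ.functor.obj A'')).inv) ≫
          (Γ.eval B b ⊗ₘ ((Γ.eval B b' ⊗ₘ ((Γ.eval B b'' ⊗ₘ MonObj.one (X := B.toLMod)) ≫
            MonObj.mul)) ≫ MonObj.mul)) ≫ MonObj.mul =
        t ≫ (Γ.act (ofEl b) ⊗ₘ ((Γ.act (ofEl b') ⊗ₘ Γ.act (ofEl b'')) ≫ MonObj.mul)) ≫
          MonObj.mul := by
      rw [finProd_two, Category.assoc, act_ofEl, act_ofEl, act_ofEl, ← id_tensorHom,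
        tensorHom_comp_tensorHom_assoc, Category.id_comp, whiskerLeft_inv_hom_assoc]
    refine hΓ.hom_ext (n := 3) (A := ![A, A', A'']) fun B b => ?_
    exact (h' f B (b 0) (b 1) (b 2)).trans ((h B _ _ _).trans (h' g B (b 0) (b 1) (b 2)).symm)
  exact (cancel_mono _).1 e

omit [IsMonoidalTheory P] in
lemma IsGood.exists_comp_act_tensor {A A' : P} {X : LMod P}
    (φ : ∀ B : Ring Λ, ((yoneda P).obj A ⟶ B.toLMod) → ((yoneda P).obj A' ⟶ B.toLMod) →
      (X ⟶ B.toLMod))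
    (hφ : ∀ {B B' : Ring Λ} (f : B ⟶ B') (b : (yoneda P).obj A ⟶ B.toLMod)
      (b' : (yoneda P).obj A' ⟶ B.toLMod),
      φ B' (b ≫ Ring.mapLMod f) (b' ≫ Ring.mapLMod f) = φ B b b' ≫ Ring.mapLMod f)
    (hl : ∀ (B : Ring Λ) (x y : (yoneda P).obj A ⟶ B.toLMod) (b' : (yoneda P).obj A' ⟶ B.toLMod),
      φ B (x + y) b' = φ B x b' + φ B y b')
    (hr : ∀ (B : Ring Λ) (b : (yoneda P).obj A ⟶ B.toLMod) (x y : (yoneda P).obj A' ⟶ B.toLMod),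
      φ B b (x + y) = φ B b x + φ B b y) :
    ∃ f : X ⟶ Γ.functor.obj A ⊗ Γ.functor.obj A', ∀ (B : Ring Λ)
      (b : (yoneda P).obj A ⟶ B.toLMod) (b' : (yoneda P).obj A' ⟶ B.toLMod),
      f ≫ (Γ.act b ⊗ₘ Γ.act b') ≫ MonObj.mul = φ B b b' := by
  obtain ⟨f, hf⟩ := hΓ.exists_hom (n := 2) (A := ![A, A'])
    (fun B b => φ B (ofEl (b 0)) (ofEl (A := A') (b 1)))
    (fun {_ B'} f b => (congrArg₂ (φ B') (ofEl_comp (A := A) (b 0) (Ring.mapLMod f)).symm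
      (ofEl_comp (A := A') (b 1) (Ring.mapLMod f)).symm).trans (hφ f _ _))
    (fun B b i x y => by
      fin_cases i
      · exact (congrArg (fun t => φ B t (ofEl (A := A') (b 1)))
          (ofEl_add (A := A) x y)).trans (hl B _ _ _)
      · exact (congrArg (fun t => φ B (ofEl (A := A) (b 0)) t)
          (ofEl_add (A := A') x y)).trans (hr B _ _ _))
  let f' : X ⟶ Γ.functor.obj A ⊗ (Γ.functor.obj A' ⊗ 𝟙_ (LMod P)) := f
  have hf' (B : Ring Λ) (b : B.toLMod.El A) (b' : B.toLMod.El A') :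
      f' ≫ (Γ.eval B b ⊗ₘ ((Γ.eval B b' ⊗ₘ MonObj.one (X := B.toLMod)) ≫
        MonObj.mul)) ≫ MonObj.mul = φ B (ofEl b) (ofEl b') :=
    hf B (Fin.cons b (Fin.cons b' finZeroElim))
  refine ⟨f' ≫ Γ.functor.obj A ◁ (ρ_ (Γ.functor.obj A')).hom, fun B b b' => ?_⟩
  rw [Category.assoc, ← finProd_two, act, act, hf', ofEl_toEl, ofEl_toEl]

end AdditiveOperations

end Action

/-! ### Maps out of tensor products are determined by representables. -/

section TensorDensity

variable {P : Type v} [Category.{u} P] [HasCoproducts.{u} P]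
  [MonoidalCategory (LMod P)] [IsMonoidalTheory P]

namespace LMod

lemma hom_ext_tensor (hP : IsBounded P) {X Y Z : LMod P} {f g : X ⊗ Y ⟶ Z}
    (h : ∀ (A A' : P) (x : (yoneda P).obj A ⟶ X) (y : (yoneda P).obj A' ⟶ Y),
      (x ⊗ₘ y) ≫ f = (x ⊗ₘ y) ≫ g) : f = g := by
  refine hom_ext_of_preserves (tensorRight Y) hP fun A x => ?_
  refine hom_ext_of_preserves (tensorLeft _) hP fun A' y => ?_
  have := h A A' x y
  simp only [MonoidalCategory.tensorHom_def', Category.assoc] at this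
  exact this

lemma hom_ext_tensor₃ (hP : IsBounded P) {X Y Z W : LMod P} {f g : X ⊗ (Y ⊗ Z) ⟶ W}
    (h : ∀ (A A' A'' : P) (x : (yoneda P).obj A ⟶ X) (y : (yoneda P).obj A' ⟶ Y)
      (z : (yoneda P).obj A'' ⟶ Z), (x ⊗ₘ (y ⊗ₘ z)) ≫ f = (x ⊗ₘ (y ⊗ₘ z)) ≫ g) : f = g := by
  refine hom_ext_of_preserves (tensorRight (Y ⊗ Z)) hP fun A x => ?_
  refine hom_ext_of_preserves (tensorRight Z ⋙ tensorLeft _) hP fun A' y => ?_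
  refine hom_ext_of_preserves (tensorLeft _ ⋙ tensorLeft _) hP fun A'' z => ?_
  have := h A A' A'' x y z
  simp only [MonoidalCategory.tensorHom_def', whiskerLeft_comp, Category.assoc] at this
  exact this

lemma exists_desc_tensor (hP : IsBounded P) {X Y Z : LMod P}
    (c : ∀ A A' : P, ((yoneda P).obj A ⟶ X) → ((yoneda P).obj A' ⟶ Y) →
      ((yoneda P).obj A ⊗ (yoneda P).obj A' ⟶ Z))
    (hc : ∀ (A₁ A₂ A₁' A₂' : P) (g : A₁ ⟶ A₂) (g' : A₁' ⟶ A₂') (x : (yoneda P).obj A₂ ⟶ X)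
      (y : (yoneda P).obj A₂' ⟶ Y), c A₁ A₁' ((yoneda P).map g ≫ x) ((yoneda P).map g' ≫ y) =
        ((yoneda P).map g ⊗ₘ (yoneda P).map g') ≫ c A₂ A₂' x y) :
    ∃ f : X ⊗ Y ⟶ Z, ∀ (A A' : P) (x : (yoneda P).obj A ⟶ X) (y : (yoneda P).obj A' ⟶ Y),
      (x ⊗ₘ y) ≫ f = c A A' x y := by
  have h₁ (A : P) (x : (yoneda P).obj A ⟶ X) : ∃ f : (yoneda P).obj A ⊗ Y ⟶ Z,
      ∀ (A' : P) (y : (yoneda P).obj A' ⟶ Y), (yoneda P).obj A ◁ y ≫ f = c A A' x y :=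
    exists_desc (tensorLeft _) hP (fun A' y => c A A' x y) fun A₁' A₂' g' y => by
      have := hc A A _ _ (𝟙 A) g' x y
      simpa using this
  choose d hd using h₁
  -- The maps `d` descend in the second variable for a fixed representable in the first. Their
  -- naturality in the first variable is again tested on representables mapping to `Y`.
  obtain ⟨f, hf⟩ := exists_desc (tensorRight Y) hP d fun A₁ A₂ g x => by
    refine hom_ext_of_preserves (tensorLeft _) hP fun A' y => ?_
    have := hc _ _ _ _ g (𝟙 A') x y
    simp only [CategoryTheory.Functor.map_id, Category.id_comp, tensorHom_id] at this
    change _ ◁ y ≫ d _ _ = _ ◁ y ≫ (yoneda P).map g ▷ Y ≫ d A₁ x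
    rw [hd, this, whisker_exchange_assoc, hd]
  refine ⟨f, fun A A' x y => ?_⟩
  rw [MonoidalCategory.tensorHom_def', Category.assoc]
  exact (congrArg _ (hf A x)).trans (hd A x A' y)

end LMod

end TensorDensity

/-! ### Maps into $H(\Gamma_A)$ and $H(\Gamma_A\otimes\Gamma_{A'})$ for a right adjoint $H$. -/

section Local

variable {P : Type v} [Category.{u} P] [HasCoproducts.{u} P]
  [MonoidalCategory (LMod P)] [BraidedCategory (LMod P)] [Preadditive P] [IsMonoidalTheory P]

open Plethory LMod

namespace AdditiveOperations

variable {Λ : Plethory P} {Γ : AdditiveOperations Λ} (hΓ : Γ.IsGood)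
  (H : LMod P ⥤ LMod P) [H.IsRightAdjoint]

include hΓ

section

variable {H}

omit hΓ [MonoidalCategory (LMod P)] [BraidedCategory (LMod P)] [IsMonoidalTheory P]
  [Preadditive P] in
-- Transposition along the adjunction reduces the statements of this section to the case where `H`
-- is the identity.
lemma _root_.Plethories.comp_map_ext_of_leftAdjoint {X Y : LMod P} {f g : X ⟶ H.obj Y}
    (h : ((Adjunction.ofIsRightAdjoint H).homEquiv X Y).symm f =
      ((Adjunction.ofIsRightAdjoint H).homEquiv X Y).symm g) : f = g :=
  ((Adjunction.ofIsRightAdjoint H).homEquiv X Y).symm.injective h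

lemma IsGood.map_hom_ext_unit {X : LMod P} {f g : X ⟶ H.obj (𝟙_ (LMod P))}
    (h : ∀ B : Ring Λ, f ≫ H.map (MonObj.one (X := B.toLMod)) =
      g ≫ H.map (MonObj.one (X := B.toLMod))) : f = g :=
  comp_map_ext_of_leftAdjoint (hΓ.hom_ext_unit fun B => by
    rw [← Adjunction.homEquiv_naturality_right_symm, h,
      Adjunction.homEquiv_naturality_right_symm])

omit hΓ [IsMonoidalTheory P] in
lemma map_hom_ext {A : P} {X : LMod P} {f g : X ⟶ H.obj (Γ.functor.obj A)}
    (h : ∀ (B : Ring Λ) (b : (yoneda P).obj A ⟶ B.toLMod),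
      f ≫ H.map (Γ.act b) = g ≫ H.map (Γ.act b)) : f = g :=
  comp_map_ext_of_leftAdjoint (Γ.act_hom_ext fun B b => by
    rw [← Adjunction.homEquiv_naturality_right_symm, h,
      Adjunction.homEquiv_naturality_right_symm])

lemma IsGood.map_hom_ext_tensor {A A' : P} {X : LMod P}
    {f g : X ⟶ H.obj (Γ.functor.obj A ⊗ Γ.functor.obj A')}
    (h : ∀ (B : Ring Λ) (b : (yoneda P).obj A ⟶ B.toLMod) (b' : (yoneda P).obj A' ⟶ B.toLMod),
      f ≫ H.map ((Γ.act b ⊗ₘ Γ.act b') ≫ MonObj.mul) =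
        g ≫ H.map ((Γ.act b ⊗ₘ Γ.act b') ≫ MonObj.mul)) : f = g :=
  comp_map_ext_of_leftAdjoint (hΓ.hom_ext_tensor fun B b b' => by
    rw [← Adjunction.homEquiv_naturality_right_symm, h,
      Adjunction.homEquiv_naturality_right_symm])

lemma IsGood.map_hom_ext_tensor₃ {A A' A'' : P} {X : LMod P}
    {f g : X ⟶ H.obj (Γ.functor.obj A ⊗ (Γ.functor.obj A' ⊗ Γ.functor.obj A''))}
    (h : ∀ (B : Ring Λ) (b : (yoneda P).obj A ⟶ B.toLMod) (b' : (yoneda P).obj A' ⟶ B.toLMod)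
      (b'' : (yoneda P).obj A'' ⟶ B.toLMod),
      f ≫ H.map ((Γ.act b ⊗ₘ ((Γ.act b' ⊗ₘ Γ.act b'') ≫ MonObj.mul)) ≫ MonObj.mul) =
        g ≫ H.map ((Γ.act b ⊗ₘ ((Γ.act b' ⊗ₘ Γ.act b'') ≫ MonObj.mul)) ≫ MonObj.mul)) :
    f = g :=
  comp_map_ext_of_leftAdjoint (hΓ.hom_ext_tensor₃ fun B b b' b'' => by
    rw [← Adjunction.homEquiv_naturality_right_symm, h,
      Adjunction.homEquiv_naturality_right_symm])

end

omit [IsMonoidalTheory P] in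
lemma IsGood.exists_comp_map_one {X : LMod P} (φ : ∀ B : Ring Λ, X ⟶ H.obj B.toLMod)
    (hφ : ∀ {B B' : Ring Λ} (f : B ⟶ B'), φ B' = φ B ≫ H.map (Ring.mapLMod f)) :
    ∃ f : X ⟶ H.obj (𝟙_ (LMod P)), ∀ B : Ring Λ,
      f ≫ H.map (MonObj.one (X := B.toLMod)) = φ B := by
  let e {Y Z : LMod P} := (Adjunction.ofIsRightAdjoint H).homEquiv Y Z
  obtain ⟨f, hf⟩ := hΓ.exists_comp_one (fun B => e.symm (φ B)) (fun {B B'} f => by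
    rw [hφ f, Adjunction.homEquiv_naturality_right_symm])
  exact ⟨e f, fun B => by
    rw [← Adjunction.homEquiv_naturality_right, hf, Equiv.apply_symm_apply]⟩

omit hΓ [IsMonoidalTheory P] in
lemma exists_comp_map_act {A : P} {X : LMod P}
    (φ : ∀ B : Ring Λ, ((yoneda P).obj A ⟶ B.toLMod) → (X ⟶ H.obj B.toLMod))
    (hφ : ∀ {B B' : Ring Λ} (f : B ⟶ B') (b : (yoneda P).obj A ⟶ B.toLMod),
      φ B' (b ≫ Ring.mapLMod f) = φ B b ≫ H.map (Ring.mapLMod f))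
    (hφ' : ∀ (B : Ring Λ) (x y : (yoneda P).obj A ⟶ B.toLMod),
      φ B (x + y) = φ B x + φ B y) :
    ∃ f : X ⟶ H.obj (Γ.functor.obj A), ∀ (B : Ring Λ) (b : (yoneda P).obj A ⟶ B.toLMod),
      f ≫ H.map (Γ.act b) = φ B b := by
  -- Additivity of the left adjoint makes transposition a group isomorphism, so the transposed
  -- family is still additive in `b`.
  have := additive_of_isLeftAdjoint H.leftAdjoint
  let e (Y Z : LMod P) := (Adjunction.ofIsRightAdjoint H).homAddEquiv Y Z
  obtain ⟨f, hf⟩ := Γ.exists_comp_act (fun B b => (e _ _).symm (φ B b))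
    (fun {B B'} f b => by
      rw [hφ]
      exact Adjunction.homEquiv_naturality_right_symm _ _ _)
    (fun B x y => by rw [hφ', map_add])
  refine ⟨e _ _ f, fun B b => ?_⟩
  refine (Adjunction.homEquiv_naturality_right _ _ _).symm.trans ?_
  rw [hf]
  exact (e _ _).apply_symm_apply _

omit [IsMonoidalTheory P] in
lemma IsGood.exists_comp_map_act_tensor {A A' : P} {X : LMod P}
    (φ : ∀ B : Ring Λ, ((yoneda P).obj A ⟶ B.toLMod) → ((yoneda P).obj A' ⟶ B.toLMod) →
      (X ⟶ H.obj B.toLMod))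
    (hφ : ∀ {B B' : Ring Λ} (f : B ⟶ B') (b : (yoneda P).obj A ⟶ B.toLMod)
      (b' : (yoneda P).obj A' ⟶ B.toLMod),
      φ B' (b ≫ Ring.mapLMod f) (b' ≫ Ring.mapLMod f) = φ B b b' ≫ H.map (Ring.mapLMod f))
    (hl : ∀ (B : Ring Λ) (x y : (yoneda P).obj A ⟶ B.toLMod) (b' : (yoneda P).obj A' ⟶ B.toLMod),
      φ B (x + y) b' = φ B x b' + φ B y b')
    (hr : ∀ (B : Ring Λ) (b : (yoneda P).obj A ⟶ B.toLMod) (x y : (yoneda P).obj A' ⟶ B.toLMod),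
      φ B b (x + y) = φ B b x + φ B b y) :
    ∃ f : X ⟶ H.obj (Γ.functor.obj A ⊗ Γ.functor.obj A'), ∀ (B : Ring Λ)
      (b : (yoneda P).obj A ⟶ B.toLMod) (b' : (yoneda P).obj A' ⟶ B.toLMod),
      f ≫ H.map ((Γ.act b ⊗ₘ Γ.act b') ≫ MonObj.mul) = φ B b b' := by
  have := additive_of_isLeftAdjoint H.leftAdjoint
  let e (Y Z : LMod P) := (Adjunction.ofIsRightAdjoint H).homAddEquiv Y Z
  obtain ⟨f, hf⟩ := hΓ.exists_comp_act_tensor (fun B b b' => (e _ _).symm (φ B b b'))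
    (fun {B B'} f b b' => by
      rw [hφ]
      exact Adjunction.homEquiv_naturality_right_symm _ _ _)
    (fun B x y b' => by rw [hl, map_add]) (fun B b x y => by rw [hr, map_add])
  refine ⟨e _ _ f, fun B b b' => ?_⟩
  refine (Adjunction.homEquiv_naturality_right _ _ _).symm.trans ?_
  rw [hf]
  exact (e _ _).apply_symm_apply _

end AdditiveOperations

end Local

/-! ### The coaction on $\Lambda$-rings and its universality. -/

section Coaction

variable {P : Type v} [Category.{u} P] [HasCoproducts.{u} P]
  [MonoidalCategory (LMod P)] [BraidedCategory (LMod P)] [Preadditive P]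

open Plethory LMod

namespace AdditiveOperations

variable {Λ : Plethory P} {Γ : AdditiveOperations Λ} (D : Coextension Γ.functor)

/-- Evaluation at `b` is an element of $\mathrm{Hom}(\Gamma_A,B)$, compatible with restriction of
`b` by `map_comp_act`. -/
lemma exists_coact (B : Ring Λ) : ∃ f : B.toLMod ⟶ D.functor.obj B.toLMod,
    ∀ (A : P) (b : (yoneda P).obj A ⟶ B.toLMod), b ≫ f = D.homEquiv (Γ.act b) :=
  exists_hom_of_yoneda _ fun A A' g b => by rw [← map_comp_act, D.homEquiv_map_comp]

/-- The coaction of `Hom(Γ, -)` on `Λ`-rings. -/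
def coact (B : Ring Λ) : B.toLMod ⟶ D.functor.obj B.toLMod := (exists_coact D B).choose

lemma comp_coact {A : P} {B : Ring Λ} (b : (yoneda P).obj A ⟶ B.toLMod) :
    b ≫ coact D B = D.univ A ≫ D.functor.map (Γ.act b) :=
  ((exists_coact D B).choose_spec A b).trans (D.univ_comp_map _).symm

lemma coact_naturality {B B' : Ring Λ} (f : B ⟶ B') :
    Ring.mapLMod f ≫ coact D B' = coact D B ≫ D.functor.map (Ring.mapLMod f) :=
  hom_ext_yoneda fun A b => by
    rw [← Category.assoc, comp_coact, ← Category.assoc, comp_coact, Category.assoc,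
      ← Functor.map_comp, act_comp]

lemma coact_naturality_assoc {B B' : Ring Λ} (f : B ⟶ B') {Z : LMod P}
    (h : D.functor.obj B'.toLMod ⟶ Z) :
    Ring.mapLMod f ≫ coact D B' ≫ h = coact D B ≫ D.functor.map (Ring.mapLMod f) ≫ h :=
  (reassoc_of% coact_naturality D f) h

/-! ### Transformations out of the coextension -/

variable {D} (hP : IsBounded P) (H : LMod P ⥤ LMod P) [H.IsRightAdjoint]

variable {H} in
-- By Yoneda, `θ` is determined by the images of the universal elements in `H.obj (Γ.functor.obj
-- A)`. These are detected by the maps `Γ.act b` to $\Lambda$-rings, which carry the universal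
-- element to `b ≫ coact D B`.
lemma natTrans_ext {θ θ' : D.functor ⟶ H}
    (h : ∀ B : Ring Λ, coact D B ≫ θ.app B.toLMod = coact D B ≫ θ'.app B.toLMod) : θ = θ' := by
  ext1
  funext M
  refine hom_ext_yoneda fun A x => ?_
  obtain ⟨f, rfl⟩ := D.exists_univ_comp_map x
  simp only [Category.assoc, NatTrans.naturality]
  simp only [← Category.assoc]
  congr 1
  refine map_hom_ext fun B b => ?_
  simp only [Category.assoc, ← NatTrans.naturality]
  rw [← Category.assoc, ← comp_coact, ← Category.assoc, ← comp_coact, Category.assoc, h,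
    Category.assoc]

variable (D) in
-- For fixed `A`, the natural additive family `b ↦ b ≫ ψ B` is represented by a map `w A` into
-- `H.obj (Γ.functor.obj A)`. This is the image of the universal element, and it determines `θ`
-- everywhere.
lemma exists_natTrans (ψ : ∀ B : Ring Λ, B.toLMod ⟶ H.obj B.toLMod)
    (hψ : ∀ {B B' : Ring Λ} (f : B ⟶ B'),
      Ring.mapLMod f ≫ ψ B' = ψ B ≫ H.map (Ring.mapLMod f)) :
    ∃ θ : D.functor ⟶ H, ∀ B : Ring Λ, coact D B ≫ θ.app B.toLMod = ψ B := by
  have h₁ (A : P) : ∃ w : (yoneda P).obj A ⟶ H.obj (Γ.functor.obj A), ∀ (B : Ring Λ)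
      (b : (yoneda P).obj A ⟶ B.toLMod), w ≫ H.map (Γ.act b) = b ≫ ψ B :=
    exists_comp_map_act H (fun B b => b ≫ ψ B) (fun f b => by simp only [Category.assoc, hψ])
      (fun B x y => by rw [Preadditive.add_comp])
  choose w hw using h₁
  have hw' {A A' : P} (g : A' ⟶ A) :
      (yoneda P).map g ≫ w A = w A' ≫ H.map (Γ.functor.map g) :=
    map_hom_ext fun B b => by
      rw [Category.assoc, Category.assoc, ← Functor.map_comp, map_comp_act, hw, hw, Category.assoc]
  have h₂ (M : LMod P) : ∃ t : D.functor.obj M ⟶ H.obj M, ∀ (A : P) (x : (yoneda P).obj A ⟶ _),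
      x ≫ t = w A ≫ H.map (D.homEquiv.symm x) :=
    exists_hom_of_yoneda _ fun A A' g x => by
      obtain ⟨f, rfl⟩ := D.homEquiv.surjective x
      rw [← D.homEquiv_map_comp, Equiv.symm_apply_apply, Equiv.symm_apply_apply, Functor.map_comp,
        reassoc_of% hw']
  choose t ht using h₂
  refine ⟨{ app := t, naturality := fun M N f => hom_ext_yoneda fun A x => ?_ }, fun B =>
    hom_ext_yoneda fun A b => ?_⟩
  · obtain ⟨g, rfl⟩ := D.homEquiv.surjective x
    rw [← Category.assoc, ← D.homEquiv_comp, ht, reassoc_of% ht, Equiv.symm_apply_apply,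
      Equiv.symm_apply_apply, Functor.map_comp]
  · rw [← Category.assoc, comp_coact, D.univ_comp_map]
    exact (ht _ _ _).trans (by rw [Equiv.symm_apply_apply, hw])

variable [IsMonoidalTheory P] (hΓ : Γ.IsGood)

include hP hΓ

variable {H} in
-- The argument of `natTrans_ext` in two variables: density reduces to pairs of universal elements,
-- and goodness for $n=2$ to products of values in $\Lambda$-rings.
lemma IsGood.tensor_ext {θ θ' : ∀ M N, D.functor.obj M ⊗ D.functor.obj N ⟶ H.obj (M ⊗ N)}
    (hθ : ∀ {M M' N N' : LMod P} (f : M ⟶ M') (g : N ⟶ N'),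
      (D.functor.map f ⊗ₘ D.functor.map g) ≫ θ M' N' = θ M N ≫ H.map (f ⊗ₘ g))
    (hθ' : ∀ {M M' N N' : LMod P} (f : M ⟶ M') (g : N ⟶ N'),
      (D.functor.map f ⊗ₘ D.functor.map g) ≫ θ' M' N' = θ' M N ≫ H.map (f ⊗ₘ g))
    (h : ∀ B : Ring Λ, (coact D B ⊗ₘ coact D B) ≫ θ B.toLMod B.toLMod ≫ H.map MonObj.mul =
      (coact D B ⊗ₘ coact D B) ≫ θ' B.toLMod B.toLMod ≫ H.map MonObj.mul)
    (M N : LMod P) : θ M N = θ' M N := by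
  refine LMod.hom_ext_tensor hP fun A A' x y => ?_
  obtain ⟨f, rfl⟩ := D.exists_univ_comp_map x
  obtain ⟨g, rfl⟩ := D.exists_univ_comp_map y
  rw [← tensorHom_comp_tensorHom, Category.assoc, Category.assoc, hθ, hθ', ← Category.assoc,
    ← Category.assoc]
  congr 1
  refine hΓ.map_hom_ext_tensor fun B b b' => ?_
  simp only [Functor.map_comp, Category.assoc]
  rw [← reassoc_of% hθ, ← reassoc_of% hθ', tensorHom_comp_tensorHom_assoc,
    tensorHom_comp_tensorHom_assoc, ← comp_coact, ← comp_coact, ← tensorHom_comp_tensorHom,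
    Category.assoc, h, Category.assoc]

variable {H} in
lemma IsGood.tensor_ext₃
    {θ θ' : ∀ L M N, D.functor.obj L ⊗ (D.functor.obj M ⊗ D.functor.obj N) ⟶
      H.obj (L ⊗ (M ⊗ N))}
    (hθ : ∀ {L L' M M' N N' : LMod P} (e : L ⟶ L') (f : M ⟶ M') (g : N ⟶ N'),
      (D.functor.map e ⊗ₘ (D.functor.map f ⊗ₘ D.functor.map g)) ≫ θ L' M' N' =
        θ L M N ≫ H.map (e ⊗ₘ (f ⊗ₘ g)))
    (hθ' : ∀ {L L' M M' N N' : LMod P} (e : L ⟶ L') (f : M ⟶ M') (g : N ⟶ N'),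
      (D.functor.map e ⊗ₘ (D.functor.map f ⊗ₘ D.functor.map g)) ≫ θ' L' M' N' =
        θ' L M N ≫ H.map (e ⊗ₘ (f ⊗ₘ g)))
    (h : ∀ B : Ring Λ, (coact D B ⊗ₘ (coact D B ⊗ₘ coact D B)) ≫
        θ B.toLMod B.toLMod B.toLMod ≫ H.map ((B.toLMod ◁ MonObj.mul) ≫ MonObj.mul) =
      (coact D B ⊗ₘ (coact D B ⊗ₘ coact D B)) ≫
        θ' B.toLMod B.toLMod B.toLMod ≫ H.map ((B.toLMod ◁ MonObj.mul) ≫ MonObj.mul))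
    (L M N : LMod P) : θ L M N = θ' L M N := by
  refine LMod.hom_ext_tensor₃ hP fun A A' A'' x y z => ?_
  obtain ⟨e, rfl⟩ := D.exists_univ_comp_map x
  obtain ⟨f, rfl⟩ := D.exists_univ_comp_map y
  obtain ⟨g, rfl⟩ := D.exists_univ_comp_map z
  rw [← tensorHom_comp_tensorHom, ← tensorHom_comp_tensorHom, Category.assoc, Category.assoc,
    hθ, hθ', ← Category.assoc, ← Category.assoc]
  congr 1
  refine hΓ.map_hom_ext_tensor₃ fun B b b' b'' => ?_
  have e₁ : (Γ.act b ⊗ₘ ((Γ.act b' ⊗ₘ Γ.act b'') ≫ MonObj.mul)) ≫ MonObj.mul =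
      (Γ.act b ⊗ₘ (Γ.act b' ⊗ₘ Γ.act b'')) ≫ (B.toLMod ◁ MonObj.mul) ≫ MonObj.mul := by
    rw [← id_tensorHom, tensorHom_comp_tensorHom_assoc, Category.comp_id]
  rw [e₁, Functor.map_comp, Category.assoc, Category.assoc]
  rw [← reassoc_of% hθ, ← reassoc_of% hθ', tensorHom_comp_tensorHom_assoc,
    tensorHom_comp_tensorHom_assoc, tensorHom_comp_tensorHom, ← comp_coact, ← comp_coact,
    ← comp_coact, ← tensorHom_comp_tensorHom, ← tensorHom_comp_tensorHom,
    Category.assoc, h, Category.assoc]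

variable (D) in
-- As in `exists_natTrans`, but `b ⊗ₘ b'` followed by `ψ B` is now biadditive in `b` and `b'`, and
-- goodness represents it by a map `w A A'`.
lemma IsGood.exists_tensor (ψ : ∀ B : Ring Λ, B.toLMod ⊗ B.toLMod ⟶ H.obj B.toLMod)
    (hψ : ∀ {B B' : Ring Λ} (f : B ⟶ B'),
      (Ring.mapLMod f ⊗ₘ Ring.mapLMod f) ≫ ψ B' = ψ B ≫ H.map (Ring.mapLMod f)) :
    ∃ θ : ∀ M N, D.functor.obj M ⊗ D.functor.obj N ⟶ H.obj (M ⊗ N),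
      (∀ {M M' N N' : LMod P} (f : M ⟶ M') (g : N ⟶ N'),
        (D.functor.map f ⊗ₘ D.functor.map g) ≫ θ M' N' = θ M N ≫ H.map (f ⊗ₘ g)) ∧
      ∀ B : Ring Λ, (coact D B ⊗ₘ coact D B) ≫ θ B.toLMod B.toLMod ≫ H.map MonObj.mul = ψ B := by
  have h₁ (A A' : P) : ∃ w : (yoneda P).obj A ⊗ (yoneda P).obj A' ⟶
      H.obj (Γ.functor.obj A ⊗ Γ.functor.obj A'), ∀ (B : Ring Λ)
      (b : (yoneda P).obj A ⟶ B.toLMod) (b' : (yoneda P).obj A' ⟶ B.toLMod),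
      w ≫ H.map ((Γ.act b ⊗ₘ Γ.act b') ≫ MonObj.mul) = (b ⊗ₘ b') ≫ ψ B :=
    hΓ.exists_comp_map_act_tensor H (fun B b b' => (b ⊗ₘ b') ≫ ψ B)
      (fun f b b' => by rw [← tensorHom_comp_tensorHom, Category.assoc, hψ, Category.assoc])
      (fun B x y b' => by rw [MonoidalPreadditive.add_tensor, Preadditive.add_comp])
      (fun B b x y => by rw [MonoidalPreadditive.tensor_add, Preadditive.add_comp])
  choose w hw using h₁
  have hw' {A₁ A₂ A₁' A₂' : P} (g : A₁ ⟶ A₂) (g' : A₁' ⟶ A₂') :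
      ((yoneda P).map g ⊗ₘ (yoneda P).map g') ≫ w A₂ A₂' =
        w A₁ A₁' ≫ H.map (Γ.functor.map g ⊗ₘ Γ.functor.map g') :=
    hΓ.map_hom_ext_tensor fun B b b' => by
      rw [Category.assoc, Category.assoc, hw, ← Functor.map_comp, tensorHom_comp_tensorHom_assoc,
        tensorHom_comp_tensorHom_assoc, map_comp_act, map_comp_act, hw]
  have h₂ (M N : LMod P) : ∃ t : D.functor.obj M ⊗ D.functor.obj N ⟶ H.obj (M ⊗ N), ∀ (A A' : P)
      (x : (yoneda P).obj A ⟶ D.functor.obj M) (y : (yoneda P).obj A' ⟶ D.functor.obj N),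
      (x ⊗ₘ y) ≫ t = w A A' ≫ H.map (D.homEquiv.symm x ⊗ₘ D.homEquiv.symm y) :=
    exists_desc_tensor hP _ fun A₁ A₂ A₁' A₂' g g' x y => by
      obtain ⟨f, rfl⟩ := D.homEquiv.surjective x
      obtain ⟨f', rfl⟩ := D.homEquiv.surjective y
      rw [← D.homEquiv_map_comp, ← D.homEquiv_map_comp]
      simp only [Equiv.symm_apply_apply]
      rw [reassoc_of% hw', ← Functor.map_comp, tensorHom_comp_tensorHom]
  choose t ht using h₂
  refine ⟨t, fun {M M' N N'} f g => LMod.hom_ext_tensor hP fun A A' x y => ?_, fun B =>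
    LMod.hom_ext_tensor hP fun A A' b b' => ?_⟩
  · obtain ⟨k, rfl⟩ := D.homEquiv.surjective x
    obtain ⟨l, rfl⟩ := D.homEquiv.surjective y
    rw [tensorHom_comp_tensorHom_assoc, ← D.homEquiv_comp, ← D.homEquiv_comp, ht, reassoc_of% ht]
    simp only [Equiv.symm_apply_apply]
    rw [← Functor.map_comp, tensorHom_comp_tensorHom]
  · rw [tensorHom_comp_tensorHom_assoc, comp_coact, comp_coact, D.univ_comp_map, D.univ_comp_map,
      reassoc_of% ht]
    simp only [Equiv.symm_apply_apply]
    rw [← Functor.map_comp, hw]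

end AdditiveOperations

end Coaction

/-! ### The lax symmetric monoidal comonad of additive operations. -/

section Structure

variable {P : Type v} [Category.{u} P] [HasCoproducts.{u} P]
  [MonoidalCategory (LMod P)] [BraidedCategory (LMod P)] [Preadditive P] [IsMonoidalTheory P]

open Plethory LMod

namespace AdditiveOperations

variable {Λ : Plethory P} {Γ : AdditiveOperations Λ} (D : Coextension Γ.functor)
  [D.functor.IsRightAdjoint]

section

omit [IsMonoidalTheory P]

omit [D.functor.IsRightAdjoint] in
lemma exists_counit : ∃ ε : D.functor ⟶ 𝟭 (LMod P),
    ∀ B : Ring Λ, coact D B ≫ ε.app B.toLMod = 𝟙 B.toLMod :=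
  exists_natTrans D (𝟭 _) (fun _ => 𝟙 _) (fun _ => by simp)

/-- The counit of the comonad of additive operations. -/
def counit : D.functor ⟶ 𝟭 (LMod P) := (exists_counit D).choose

omit [D.functor.IsRightAdjoint] in
lemma coact_counit (B : Ring Λ) : coact D B ≫ (counit D).app B.toLMod = 𝟙 B.toLMod :=
  (exists_counit D).choose_spec B

omit [D.functor.IsRightAdjoint] in
lemma coact_counit_assoc (B : Ring Λ) {Z : LMod P} (h : B.toLMod ⟶ Z) :
    coact D B ≫ (counit D).app B.toLMod ≫ h = h :=
  (reassoc_of% coact_counit D B) h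

/-- The composite of right adjoints is a right adjoint, so the iterated coaction is a legitimate
prescription. -/
lemma exists_comult : ∃ δ : D.functor ⟶ D.functor ⋙ D.functor,
    ∀ B : Ring Λ, coact D B ≫ δ.app B.toLMod = coact D B ≫ D.functor.map (coact D B) :=
  exists_natTrans D (D.functor ⋙ D.functor) (fun B => coact D B ≫ D.functor.map (coact D B))
    (fun f => by
      simp only [coact_naturality_assoc, Category.assoc, Functor.comp_map, ← Functor.map_comp,
        coact_naturality])

/-- The comultiplication of the comonad of additive operations. -/
def comult : D.functor ⟶ D.functor ⋙ D.functor := (exists_comult D).choose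

lemma coact_comult (B : Ring Λ) :
    coact D B ≫ (comult D).app B.toLMod = coact D B ≫ D.functor.map (coact D B) :=
  (exists_comult D).choose_spec B

lemma coact_comult_assoc (B : Ring Λ) {Z : LMod P}
    (h : D.functor.obj (D.functor.obj B.toLMod) ⟶ Z) :
    coact D B ≫ (comult D).app B.toLMod ≫ h = coact D B ≫ D.functor.map (coact D B) ≫ h :=
  (reassoc_of% coact_comult D B) h

/-- The comonad of additive operations. -/
def comonad : Comonad (LMod P) where
  toFunctor := D.functor
  ε := counit D
  δ := comult D
  coassoc := by
    -- As for the counit laws below, both sides are transformations from `D.functor` to a right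
    -- adjoint, so they are compared after `coact`.
    refine congr_app (natTrans_ext (H := D.functor ⋙ D.functor ⋙ D.functor)
      (θ := comult D ≫ Functor.whiskerRight (comult D) D.functor)
      (θ' := comult D ≫ Functor.whiskerLeft D.functor (comult D)) fun B => ?_)
    have h := (comult D).naturality (coact D B)
    simp only [Functor.comp_map] at h
    simp only [NatTrans.comp_app, Functor.whiskerRight_app, Functor.whiskerLeft_app]
    trans coact D B ≫ D.functor.map (coact D B) ≫ D.functor.map (D.functor.map (coact D B))
    · rw [coact_comult_assoc, ← Functor.map_comp, coact_comult, Functor.map_comp]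
    · rw [coact_comult_assoc, h, coact_comult_assoc]
  left_counit := by
    refine congr_app (natTrans_ext (H := D.functor)
      (θ := comult D ≫ Functor.whiskerLeft D.functor (counit D)) (θ' := 𝟙 _) fun B => ?_)
    have h := (counit D).naturality (coact D B)
    simp only [Functor.id_map] at h
    simp only [NatTrans.comp_app, Functor.whiskerLeft_app, NatTrans.id_app, Category.comp_id]
    rw [coact_comult_assoc]
    refine (congrArg (coact D B ≫ ·) h).trans ?_
    exact coact_counit_assoc _ _ _
  right_counit := by
    refine congr_app (natTrans_ext (H := D.functor)
      (θ := comult D ≫ Functor.whiskerRight (counit D) D.functor) (θ' := 𝟙 _) fun B => ?_)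
    simp only [NatTrans.comp_app, Functor.whiskerRight_app, NatTrans.id_app, Category.comp_id]
    rw [coact_comult_assoc, ← Functor.map_comp, coact_counit]
    exact (congrArg _ (D.functor.map_id _)).trans (Category.comp_id _)

end

variable (hP : IsBounded P) (hΓ : Γ.IsGood)

omit [IsMonoidalTheory P] in
include hΓ in
lemma IsGood.exists_laxUnit : ∃ ε : 𝟙_ (LMod P) ⟶ D.functor.obj (𝟙_ (LMod P)),
    ∀ B : Ring Λ, ε ≫ D.functor.map (MonObj.one (X := B.toLMod)) = MonObj.one ≫ coact D B :=
  hΓ.exists_comp_map_one D.functor (fun B => MonObj.one ≫ coact D B) (fun {B B'} f => by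
    rw [Category.assoc, ← coact_naturality, IsMonHom.one_hom_assoc])

include hP hΓ in
-- The condition on `B` says that `coact D B` is multiplicative for the ring structure induced on
-- its target; `exists_laxUnit` does the same for units.
lemma IsGood.exists_tensorator :
    ∃ μ : ∀ M N, D.functor.obj M ⊗ D.functor.obj N ⟶ D.functor.obj (M ⊗ N),
      (∀ {M M' N N' : LMod P} (f : M ⟶ M') (g : N ⟶ N'),
        (D.functor.map f ⊗ₘ D.functor.map g) ≫ μ M' N' = μ M N ≫ D.functor.map (f ⊗ₘ g)) ∧
      ∀ B : Ring Λ, (coact D B ⊗ₘ coact D B) ≫ μ B.toLMod B.toLMod ≫ D.functor.map MonObj.mul =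
        MonObj.mul ≫ coact D B :=
  hΓ.exists_tensor D hP D.functor (fun B => MonObj.mul ≫ coact D B) (fun f => by
    rw [Category.assoc, ← coact_naturality, IsMonHom.mul_hom_assoc])

/-- The unit of the lax monoidal structure on the comonad of additive operations. -/
def IsGood.laxUnit : 𝟙_ (LMod P) ⟶ D.functor.obj (𝟙_ (LMod P)) := (hΓ.exists_laxUnit D).choose

omit [IsMonoidalTheory P] in
lemma IsGood.laxUnit_comp_map (B : Ring Λ) :
    hΓ.laxUnit D ≫ D.functor.map (MonObj.one (X := B.toLMod)) = MonObj.one ≫ coact D B :=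
  (hΓ.exists_laxUnit D).choose_spec B

omit [IsMonoidalTheory P] in
lemma IsGood.laxUnit_comp_map_assoc (B : Ring Λ) {Z : LMod P}
    (h : D.functor.obj B.toLMod ⟶ Z) :
    hΓ.laxUnit D ≫ D.functor.map (MonObj.one (X := B.toLMod)) ≫ h =
      MonObj.one ≫ coact D B ≫ h :=
  (reassoc_of% hΓ.laxUnit_comp_map D B) h

/-- The tensorator of the lax monoidal structure on the comonad of additive operations. -/
def IsGood.tensorator (M N : LMod P) :
    D.functor.obj M ⊗ D.functor.obj N ⟶ D.functor.obj (M ⊗ N) :=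
  (hΓ.exists_tensorator D hP).choose M N

lemma IsGood.tensorator_naturality {M M' N N' : LMod P} (f : M ⟶ M') (g : N ⟶ N') :
    (D.functor.map f ⊗ₘ D.functor.map g) ≫ hΓ.tensorator D hP M' N' =
      hΓ.tensorator D hP M N ≫ D.functor.map (f ⊗ₘ g) :=
  (hΓ.exists_tensorator D hP).choose_spec.1 f g

lemma IsGood.tensorator_naturality_assoc {M M' N N' : LMod P} (f : M ⟶ M') (g : N ⟶ N')
    {Z : LMod P} (h : D.functor.obj (M' ⊗ N') ⟶ Z) :
    (D.functor.map f ⊗ₘ D.functor.map g) ≫ hΓ.tensorator D hP M' N' ≫ h =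
      hΓ.tensorator D hP M N ≫ D.functor.map (f ⊗ₘ g) ≫ h :=
  (reassoc_of% hΓ.tensorator_naturality D hP f g) h

lemma IsGood.tensorator_naturality_left {M M' N : LMod P} (f : M ⟶ M') :
    D.functor.map f ▷ D.functor.obj N ≫ hΓ.tensorator D hP M' N =
      hΓ.tensorator D hP M N ≫ D.functor.map (f ▷ N) := by
  simpa using hΓ.tensorator_naturality D hP f (𝟙 N)

lemma IsGood.tensorator_naturality_left_assoc {M M' N : LMod P} (f : M ⟶ M')
    {Z : LMod P} (h : D.functor.obj (M' ⊗ N) ⟶ Z) :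
    D.functor.map f ▷ D.functor.obj N ≫ hΓ.tensorator D hP M' N ≫ h =
      hΓ.tensorator D hP M N ≫ D.functor.map (f ▷ N) ≫ h :=
  (reassoc_of% hΓ.tensorator_naturality_left D hP f) h

lemma IsGood.tensorator_naturality_right {M N N' : LMod P} (f : N ⟶ N') :
    D.functor.obj M ◁ D.functor.map f ≫ hΓ.tensorator D hP M N' =
      hΓ.tensorator D hP M N ≫ D.functor.map (M ◁ f) := by
  simpa using hΓ.tensorator_naturality D hP (𝟙 M) f

lemma IsGood.tensorator_naturality_right_assoc {M N N' : LMod P} (f : N ⟶ N')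
    {Z : LMod P} (h : D.functor.obj (M ⊗ N') ⟶ Z) :
    D.functor.obj M ◁ D.functor.map f ≫ hΓ.tensorator D hP M N' ≫ h =
      hΓ.tensorator D hP M N ≫ D.functor.map (M ◁ f) ≫ h :=
  (reassoc_of% hΓ.tensorator_naturality_right D hP f) h

lemma IsGood.tensorator_comp_map (B : Ring Λ) :
    (coact D B ⊗ₘ coact D B) ≫ hΓ.tensorator D hP B.toLMod B.toLMod ≫
      D.functor.map MonObj.mul = MonObj.mul ≫ coact D B :=
  (hΓ.exists_tensorator D hP).choose_spec.2 B

lemma IsGood.tensorator_comp_map_assoc (B : Ring Λ) {Z : LMod P}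
    (h : D.functor.obj B.toLMod ⟶ Z) :
    (coact D B ⊗ₘ coact D B) ≫ hΓ.tensorator D hP B.toLMod B.toLMod ≫
      D.functor.map MonObj.mul ≫ h = MonObj.mul ≫ coact D B ≫ h := by
  simpa only [Category.assoc] using congrArg (· ≫ h) (hΓ.tensorator_comp_map D hP B)

lemma IsGood.tensorator_associativity (X Y Z : LMod P) :
    hΓ.tensorator D hP X Y ▷ D.functor.obj Z ≫ hΓ.tensorator D hP (X ⊗ Y) Z ≫
        D.functor.map (α_ X Y Z).hom =
      (α_ (D.functor.obj X) (D.functor.obj Y) (D.functor.obj Z)).hom ≫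
        D.functor.obj X ◁ hΓ.tensorator D hP Y Z ≫ hΓ.tensorator D hP X (Y ⊗ Z) := by
  -- Both sides must start at the right-bracketed tensor product for `tensor_ext₃` to apply.
  rw [← Iso.inv_comp_eq]
  refine hΓ.tensor_ext₃ hP (H := D.functor)
    (θ := fun X Y Z => (α_ _ _ _).inv ≫ hΓ.tensorator D hP X Y ▷ D.functor.obj Z ≫
      hΓ.tensorator D hP (X ⊗ Y) Z ≫ D.functor.map (α_ X Y Z).hom)
    (θ' := fun X Y Z => D.functor.obj X ◁ hΓ.tensorator D hP Y Z ≫ hΓ.tensorator D hP X (Y ⊗ Z))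
    ?_ ?_ ?_ X Y Z
  · intro L L' M M' N N' e f g
    rw [associator_inv_naturality_assoc]
    simp only [Category.assoc]
    congr 1
    simp only [← tensorHom_id, tensorHom_comp_tensorHom_assoc, Category.comp_id]
    rw [tensorator_naturality, ← Functor.map_comp, ← associator_naturality, Functor.map_comp,
      ← tensorator_naturality_assoc, tensorHom_comp_tensorHom_assoc, Category.id_comp]
  · intro L L' M M' N N' e f g
    simp only [← id_tensorHom, tensorHom_comp_tensorHom_assoc, Category.comp_id, Category.assoc]
    rw [← tensorator_naturality, tensorHom_comp_tensorHom_assoc, Category.id_comp,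
      tensorator_naturality]
  · intro B
    -- On a $\Lambda$-ring each bracketing becomes a triple product followed by `coact`. The two
    -- triple products agree by associativity in `B`.
    have h₁ : (coact D B ⊗ₘ (coact D B ⊗ₘ coact D B)) ≫
        (D.functor.obj B.toLMod ◁ hΓ.tensorator D hP B.toLMod B.toLMod ≫
          hΓ.tensorator D hP B.toLMod (B.toLMod ⊗ B.toLMod)) ≫
          D.functor.map ((B.toLMod ◁ MonObj.mul) ≫ MonObj.mul) =
        B.toLMod ◁ MonObj.mul ≫ MonObj.mul ≫ coact D B := by
      rw [Functor.map_comp, Category.assoc, ← tensorator_naturality_right_assoc]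
      simp only [← id_tensorHom, tensorHom_comp_tensorHom_assoc, Category.comp_id]
      rw [← hΓ.tensorator_comp_map D hP, tensorHom_comp_tensorHom_assoc, Category.id_comp,
        tensorator_comp_map]
    have h₂ : ((coact D B ⊗ₘ coact D B) ⊗ₘ coact D B) ≫
        (hΓ.tensorator D hP B.toLMod B.toLMod ▷ D.functor.obj B.toLMod ≫
          hΓ.tensorator D hP (B.toLMod ⊗ B.toLMod) B.toLMod) ≫
          D.functor.map ((MonObj.mul ▷ B.toLMod) ≫ MonObj.mul) =
        MonObj.mul ▷ B.toLMod ≫ MonObj.mul ≫ coact D B := by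
      rw [Functor.map_comp, Category.assoc, ← tensorator_naturality_left_assoc]
      simp only [← tensorHom_id, tensorHom_comp_tensorHom_assoc, Category.comp_id]
      rw [← hΓ.tensorator_comp_map D hP, tensorHom_comp_tensorHom_assoc, Category.id_comp,
        tensorator_comp_map]
    rw [h₁]
    simp only [Category.assoc]
    rw [associator_inv_naturality_assoc, ← Functor.map_comp, ← MonObj.mul_assoc]
    simp only [Category.assoc] at h₂
    rw [h₂, MonObj.mul_assoc_assoc, Iso.inv_hom_id_assoc]

/-- Composed with the inverse unitor, the right hand side is an endomorphism of `D.functor`. It is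
the identity since on a $\Lambda$-ring it expresses that `1` is a left unit. -/
lemma IsGood.tensorator_left_unitality (X : LMod P) :
    (λ_ (D.functor.obj X)).hom = hΓ.laxUnit D ▷ D.functor.obj X ≫
      hΓ.tensorator D hP (𝟙_ (LMod P)) X ≫ D.functor.map (λ_ X).hom := by
  refine ((Iso.inv_comp_eq_id _).1 ?_).symm
  refine congr_app (natTrans_ext (H := D.functor) (θ :=
    { app := fun X => (λ_ (D.functor.obj X)).inv ≫ hΓ.laxUnit D ▷ D.functor.obj X ≫
        hΓ.tensorator D hP (𝟙_ (LMod P)) X ≫ D.functor.map (λ_ X).hom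
      naturality := fun X Y f => ?_ }) (θ' := 𝟙 _) fun B => ?_) X
  · rw [leftUnitor_inv_naturality_assoc, whisker_exchange_assoc,
      tensorator_naturality_right_assoc]
    simp only [Category.assoc, ← Functor.map_comp, leftUnitor_naturality]
  · simp only [NatTrans.id_app, Category.comp_id]
    rw [leftUnitor_inv_naturality_assoc, ← MonObj.one_mul, Functor.map_comp,
      ← tensorator_naturality_left_assoc]
    simp only [← id_tensorHom, ← tensorHom_id, tensorHom_comp_tensorHom_assoc, Category.comp_id,
      Category.id_comp]
    have h : MonObj.one ≫ coact D B ⊗ₘ coact D B =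
      (MonObj.one ▷ B.toLMod) ≫ (coact D B ⊗ₘ coact D B) := by
      rw [← tensorHom_id, tensorHom_comp_tensorHom, Category.id_comp]
    rw [laxUnit_comp_map, h, Category.assoc, tensorator_comp_map, MonObj.one_mul_assoc,
      Iso.inv_hom_id_assoc]

lemma IsGood.tensorator_right_unitality (X : LMod P) :
    (ρ_ (D.functor.obj X)).hom = D.functor.obj X ◁ hΓ.laxUnit D ≫
      hΓ.tensorator D hP X (𝟙_ (LMod P)) ≫ D.functor.map (ρ_ X).hom := by
  refine ((Iso.inv_comp_eq_id _).1 ?_).symm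
  refine congr_app (natTrans_ext (H := D.functor) (θ :=
    { app := fun X => (ρ_ (D.functor.obj X)).inv ≫ D.functor.obj X ◁ hΓ.laxUnit D ≫
        hΓ.tensorator D hP X (𝟙_ (LMod P)) ≫ D.functor.map (ρ_ X).hom
      naturality := fun X Y f => ?_ }) (θ' := 𝟙 _) fun B => ?_) X
  · rw [rightUnitor_inv_naturality_assoc, ← whisker_exchange_assoc,
      tensorator_naturality_left_assoc]
    simp only [Category.assoc, ← Functor.map_comp, rightUnitor_naturality]
  · simp only [NatTrans.id_app, Category.comp_id]
    rw [rightUnitor_inv_naturality_assoc, ← MonObj.mul_one, Functor.map_comp,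
      ← tensorator_naturality_right_assoc]
    simp only [← id_tensorHom, ← tensorHom_id, tensorHom_comp_tensorHom_assoc, Category.comp_id,
      Category.id_comp]
    have h : coact D B ⊗ₘ MonObj.one ≫ coact D B =
      (B.toLMod ◁ MonObj.one) ≫ (coact D B ⊗ₘ coact D B) := by
      rw [← id_tensorHom, tensorHom_comp_tensorHom, Category.id_comp]
    rw [laxUnit_comp_map, h, Category.assoc, tensorator_comp_map, MonObj.mul_one_assoc,
      Iso.inv_hom_id_assoc]

/-- Commutativity of $\Lambda$-rings, by `tensor_ext`. -/
lemma IsGood.tensorator_braided (X Y : LMod P) :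
    hΓ.tensorator D hP X Y ≫ D.functor.map (β_ X Y).hom =
      (β_ (D.functor.obj X) (D.functor.obj Y)).hom ≫ hΓ.tensorator D hP Y X := by
  suffices h : hΓ.tensorator D hP X Y = (β_ (D.functor.obj X) (D.functor.obj Y)).hom ≫
      hΓ.tensorator D hP Y X ≫ D.functor.map (β_ X Y).inv by
    rw [h, Category.assoc, Category.assoc, ← Functor.map_comp, Iso.inv_hom_id,
      CategoryTheory.Functor.map_id, Category.comp_id]
  refine hΓ.tensor_ext hP (H := D.functor) (θ := hΓ.tensorator D hP)
    (θ' := fun X Y => (β_ (D.functor.obj X) (D.functor.obj Y)).hom ≫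
      hΓ.tensorator D hP Y X ≫ D.functor.map (β_ X Y).inv) (hΓ.tensorator_naturality D hP) ?_ ?_ X Y
  · intro M M' N N' f g
    rw [BraidedCategory.braiding_naturality_assoc, tensorator_naturality_assoc]
    simp only [Category.assoc, ← Functor.map_comp, BraidedCategory.braiding_inv_naturality]
  · intro B
    have h : (β_ B.toLMod B.toLMod).inv ≫ MonObj.mul = MonObj.mul := by
      rw [Iso.inv_comp_eq, IsCommMonObj.mul_comm]
    simp only [Category.assoc]
    rw [← Functor.map_comp, h, BraidedCategory.braiding_naturality_assoc, tensorator_comp_map,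
      IsCommMonObj.mul_comm_assoc]

/-- The lax symmetric monoidal structure on the comonad of additive operations. -/
@[reducible]
def IsGood.laxBraided : D.functor.LaxBraided where
  ε := hΓ.laxUnit D
  μ := hΓ.tensorator D hP
  μ_natural_left f _ := hΓ.tensorator_naturality_left D hP f
  μ_natural_right _ f := hΓ.tensorator_naturality_right D hP f
  associativity := hΓ.tensorator_associativity D hP
  left_unitality := hΓ.tensorator_left_unitality D hP
  right_unitality := hΓ.tensorator_right_unitality D hP
  braided := hΓ.tensorator_braided D hP

end AdditiveOperations

end Structure

/-! ### Morphisms of comonads as natural coactions on coalgebras. -/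

section Comonads

variable {C : Type w} [Category.{v} C] {T U : Comonad C}

/-- A morphism of comonads `T ⟶ U` turns `T`-coalgebras into `U`-coalgebras. -/
def comonadCoaction (τ : T ⟶ U) (B : T.Coalgebra) : B.A ⟶ U.obj B.A :=
  B.a ≫ τ.app B.A

lemma comonadCoaction_naturality (τ : T ⟶ U) {B B' : T.Coalgebra} (f : B ⟶ B') :
    f.f ≫ comonadCoaction τ B' = comonadCoaction τ B ≫ U.map f.f := by
  unfold comonadCoaction
  rw [← f.h_assoc, Category.assoc, τ.naturality]

lemma comonadCoaction_counit (τ : T ⟶ U) (B : T.Coalgebra) :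
    comonadCoaction τ B ≫ U.ε.app B.A = 𝟙 B.A := by
  unfold comonadCoaction
  rw [Category.assoc, τ.app_ε, B.counit]

lemma comonadCoaction_comult (τ : T ⟶ U) (B : T.Coalgebra) :
    comonadCoaction τ B ≫ U.δ.app B.A =
      comonadCoaction τ B ≫ U.map (comonadCoaction τ B) := by
  unfold comonadCoaction
  rw [Category.assoc, τ.app_δ, B.coassoc_assoc, Functor.map_comp, Category.assoc,
    τ.naturality_assoc]

/-- A comonad morphism is recovered from its coaction on cofree coalgebras by the counit. -/
lemma app_eq_comonadCoaction (τ : T ⟶ U) (R : C) :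
    τ.app R = comonadCoaction τ (T.cofree.obj R) ≫ U.map (T.ε.app R) := by
  refine Eq.trans ?_ (Category.assoc _ _ _).symm
  refine Eq.trans ?_ (congrArg (T.δ.app R ≫ ·) (τ.naturality (T.ε.app R)))
  exact (T.right_counit_assoc _ _).symm

lemma comonadHom_ext {τ τ' : T ⟶ U}
    (h : ∀ B : T.Coalgebra, comonadCoaction τ B = comonadCoaction τ' B) : τ = τ' :=
  ComonadHom.ext (funext fun R => by rw [app_eq_comonadCoaction, h, ← app_eq_comonadCoaction])

/-- A natural family of `U`-coalgebra structures on `T`-coalgebras comes from a morphism of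
comonads. -/
lemma exists_comonadHom (Ψ : ∀ B : T.Coalgebra, B.A ⟶ U.obj B.A)
    (hΨ : ∀ {B B' : T.Coalgebra} (f : B ⟶ B'), f.f ≫ Ψ B' = Ψ B ≫ U.map f.f)
    (h_counit : ∀ B, Ψ B ≫ U.ε.app B.A = 𝟙 B.A)
    (h_comult : ∀ B, Ψ B ≫ U.δ.app B.A = Ψ B ≫ U.map (Ψ B)) :
    ∃ τ : T ⟶ U, ∀ B, comonadCoaction τ B = Ψ B := by
  let Φ (R : C) : T.obj R ⟶ U.obj (T.obj R) := Ψ (T.cofree.obj R)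
  have hΦ {R R' : C} (f : R ⟶ R') : T.map f ≫ Φ R' = Φ R ≫ U.map (T.map f) := hΨ (T.cofree.map f)
  have hΦ_counit (R : C) : Φ R ≫ U.ε.app (T.obj R) = 𝟙 (T.obj R) := h_counit _
  have hΦ_comult (R : C) : Φ R ≫ U.δ.app (T.obj R) = Φ R ≫ U.map (Φ R) := h_comult _
  -- The structure map of `B` is itself a coalgebra map to the cofree coalgebra on `B.A`, so
  -- naturality of `Ψ` applies to it.
  have ha (B : T.Coalgebra) : B.a ≫ Φ B.A = Ψ B ≫ U.map B.a :=
    hΨ (B' := T.cofree.obj B.A) ⟨B.a, B.coassoc.symm⟩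
  have hδ (R : C) : T.δ.app R ≫ Φ (T.obj R) = Φ R ≫ U.map (T.δ.app R) := ha (T.cofree.obj R)
  refine ⟨{ app := fun R => Φ R ≫ U.map (T.ε.app R)
            naturality := fun R R' f => ?_
            app_ε := fun R => ?_
            app_δ := fun R => ?_ }, fun B => ?_⟩
  · have h := T.ε.naturality f
    simp only [Functor.id_map] at h
    rw [Category.assoc, ← Functor.map_comp, ← h, Functor.map_comp, reassoc_of% hΦ]
  · have h := U.ε.naturality (T.ε.app R)
    simp only [Functor.id_map] at h
    exact (Category.assoc _ _ _).trans ((congrArg (Φ R ≫ ·) h).trans ((reassoc_of% hΦ_counit) _ _))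
  · have h := U.δ.naturality (T.ε.app R)
    simp only [Functor.comp_map] at h
    refine (Category.assoc _ _ _).trans ((congrArg (Φ R ≫ ·) h).trans ?_)
    rw [Category.assoc, reassoc_of% hδ, reassoc_of% hΦ_comult]
    simp only [← Functor.map_comp]
    exact congrArg (fun k => Φ R ≫ U.map k) (T.left_counit_assoc R _).symm
  · change B.a ≫ Φ B.A ≫ U.map (T.ε.app B.A) = Ψ B
    rw [reassoc_of% ha, ← Functor.map_comp, B.counit]
    exact (congrArg _ (U.map_id _)).trans (Category.comp_id _)

end Comonads

/-! ### Morphisms $SG\to\Lambda$ as multiplicative coactions. -/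

section Actions

variable {P : Type v} [Category.{u} P] [HasCoproducts.{u} P]
  [MonoidalCategory (LMod P)] [BraidedCategory (LMod P)]

open Plethory

section

variable {Λ : Plethory P} {G : Cobialgebroid (LMod P)}
  (τ : (freePlethory (LMod P)).obj G ⟶ Λ.obj)

/-- The map of rings `B ⟶ G^∨ B` that is adjoint to the action of `G` on a `Λ`-ring `B`. -/
def ringCoaction (B : Ring Λ) : B.A ⟶ G.dual.toFunctor.mapCommMon.obj B.A :=
  comonadCoaction (U := G.ringComonad) τ.unop B

/-- The map `B ⟶ G^∨ B` that is adjoint to the action of `G` on a `Λ`-ring `B`. -/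
def coaction (B : Ring Λ) : B.toLMod ⟶ G.dual.obj B.toLMod := (ringCoaction τ B).hom.hom

lemma coaction_naturality {B B' : Ring Λ} (f : B ⟶ B') :
    Ring.mapLMod f ≫ coaction τ B' = coaction τ B ≫ G.dual.map (Ring.mapLMod f) :=
  congrArg (fun g => g.hom.hom) (comonadCoaction_naturality (U := G.ringComonad) τ.unop f)

lemma coaction_counit (B : Ring Λ) : coaction τ B ≫ G.dual.ε.app B.toLMod = 𝟙 B.toLMod := by
  have h := congrArg (fun g => g.hom.hom)
    (comonadCoaction_counit (U := G.ringComonad) τ.unop B)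
  change coaction τ B ≫ G.dual.ε.app B.toLMod ≫ 𝟙 _ = 𝟙 B.toLMod at h
  exact (congrArg (coaction τ B ≫ ·) (Category.comp_id _).symm).trans h

lemma coaction_comult (B : Ring Λ) :
    coaction τ B ≫ G.dual.δ.app B.toLMod = coaction τ B ≫ G.dual.map (coaction τ B) := by
  have h := congrArg (fun g => g.hom.hom)
    (comonadCoaction_comult (U := G.ringComonad) τ.unop B)
  change coaction τ B ≫ G.dual.δ.app B.toLMod ≫ 𝟙 _ =
    coaction τ B ≫ G.dual.map (coaction τ B) at h
  exact (congrArg (coaction τ B ≫ ·) (Category.comp_id _).symm).trans h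

lemma one_coaction (B : Ring Λ) :
    MonObj.one ≫ coaction τ B = Functor.LaxMonoidal.ε G.dual.toFunctor ≫
      G.dual.map (MonObj.one (X := B.toLMod)) :=
  IsMonHom.one_hom (ringCoaction τ B).hom.hom

lemma mul_coaction (B : Ring Λ) :
    MonObj.mul ≫ coaction τ B = (coaction τ B ⊗ₘ coaction τ B) ≫
      Functor.LaxMonoidal.μ G.dual.toFunctor B.toLMod B.toLMod ≫
        G.dual.map (MonObj.mul (X := B.toLMod)) :=
  IsMonHom.mul_hom (ringCoaction τ B).hom.hom

/-- A morphism `SG ⟶ Λ` is determined by the coactions. -/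
lemma hom_ext_coaction {τ τ' : (freePlethory (LMod P)).obj G ⟶ Λ.obj}
    (h : ∀ B : Ring Λ, coaction τ B = coaction τ' B) : τ = τ' :=
  Quiver.Hom.unop_inj (comonadHom_ext (U := G.ringComonad) fun B => CommMon.hom_ext _ _ (h B))

/-- A natural family of coactions on `Λ`-rings that are ring homomorphisms, compatible with the
comonad structure of `G^∨`, comes from a morphism `SG ⟶ Λ`. -/
lemma exists_hom_of_coaction (ψ : ∀ B : Ring Λ, B.toLMod ⟶ G.dual.obj B.toLMod)
    (hψ : ∀ {B B' : Ring Λ} (f : B ⟶ B'),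
      Ring.mapLMod f ≫ ψ B' = ψ B ≫ G.dual.map (Ring.mapLMod f))
    (h_counit : ∀ B : Ring Λ, ψ B ≫ G.dual.ε.app B.toLMod = 𝟙 B.toLMod)
    (h_comult : ∀ B : Ring Λ, ψ B ≫ G.dual.δ.app B.toLMod = ψ B ≫ G.dual.map (ψ B))
    (h_one : ∀ B : Ring Λ, MonObj.one ≫ ψ B = Functor.LaxMonoidal.ε G.dual.toFunctor ≫
      G.dual.map (MonObj.one (X := B.toLMod)))
    (h_mul : ∀ B : Ring Λ, MonObj.mul ≫ ψ B = (ψ B ⊗ₘ ψ B) ≫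
      Functor.LaxMonoidal.μ G.dual.toFunctor B.toLMod B.toLMod ≫
        G.dual.map (MonObj.mul (X := B.toLMod))) :
    ∃ τ : (freePlethory (LMod P)).obj G ⟶ Λ.obj, ∀ B : Ring Λ, coaction τ B = ψ B := by
  obtain ⟨τ, hτ⟩ := exists_comonadHom (T := Λ.obj.unop) (U := G.ringComonad)
    (fun B => CommMon.homMk (Mon.Hom.mk' (ψ B) (h_one B) (h_mul B)))
    (fun f => CommMon.hom_ext _ _ (hψ f))
    (fun B => CommMon.hom_ext _ _ ((congrArg (ψ B ≫ ·) (Category.comp_id _)).trans (h_counit B)))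
    (fun B => CommMon.hom_ext _ _ ((congrArg (ψ B ≫ ·) (Category.comp_id _)).trans (h_comult B)))
  exact ⟨τ.op, fun B => congrArg (fun g => g.hom.hom) (hτ B)⟩

variable {τ} in
lemma action_eq_symm (B : Ring Λ) {M : LMod P} (m : M ⟶ B.toLMod) :
    action τ B m = (G.adj.homEquiv M B.toLMod).symm (m ≫ coaction τ B) := rfl

end

end Actions

/-! ### Formal laws of the action of $G$. -/

section FormalActions

variable {P : Type v} [Category.{u} P] [HasCoproducts.{u} P]
  [MonoidalCategory (LMod P)] [BraidedCategory (LMod P)]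

open Plethory

variable {Λ : Plethory P} {G : Cobialgebroid (LMod P)}
  (τ : (freePlethory (LMod P)).obj G ⟶ Λ.obj)

lemma unit_comp_map_action (B : Ring Λ) {M : LMod P} (m : M ⟶ B.toLMod) :
    G.adj.unit.app M ≫ G.dual.map (action τ B m) = m ≫ coaction τ B :=
  (G.adj.homEquiv_unit ..).symm.trans ((G.adj.homEquiv _ _).apply_symm_apply _)

lemma unit_comp_map_action_assoc (B : Ring Λ) {M : LMod P} (m : M ⟶ B.toLMod) {Z : LMod P}
    (h : G.dual.obj B.toLMod ⟶ Z) :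
    G.adj.unit.app M ≫ G.dual.map (action τ B m) ≫ h = m ≫ coaction τ B ≫ h :=
  (reassoc_of% unit_comp_map_action τ B m) h

/-- This and the next three laws hold for any cobialgebroid and any `τ`: they are the transposes of
`coaction_counit`, `coaction_comult`, `one_coaction` and `mul_coaction`. -/
lemma unit_comp_action (B : Ring Λ) {M : LMod P} (m : M ⟶ B.toLMod) :
    G.unit M ≫ action τ B m = m := by
  have h := G.dual.ε.naturality (action τ B m)
  simp only [Functor.id_map] at h
  refine (Category.assoc _ _ _).trans ((congrArg (G.adj.unit.app M ≫ ·) h.symm).trans ?_)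
  refine (unit_comp_map_action_assoc τ B m _).trans ?_
  exact (congrArg (m ≫ ·) (coaction_counit τ B)).trans (Category.comp_id _)

lemma mul_comp_action (B : Ring Λ) {M : LMod P} (m : M ⟶ B.toLMod) :
    G.mul M ≫ action τ B m = action τ B (action τ B m) := by
  have h := G.dual.δ.naturality (action τ B m)
  simp only [Functor.comp_map] at h
  unfold Cobialgebroid.mul
  rw [← Adjunction.homEquiv_naturality_right_symm, ← Adjunction.homEquiv_naturality_right_symm,
    Category.assoc]
  refine (congrArg (fun k => (G.adj.homEquiv _ _).symm ((G.adj.homEquiv _ _).symm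
    (G.adj.unit.app M ≫ k))) h.symm).trans ?_
  refine (congrArg (fun k => (G.adj.homEquiv _ _).symm ((G.adj.homEquiv _ _).symm k))
    (unit_comp_map_action_assoc τ B m _)).trans ?_
  refine (congrArg (fun k => (G.adj.homEquiv _ _).symm ((G.adj.homEquiv _ _).symm
    (m ≫ k))) (coaction_comult τ B)).trans ?_
  rw [← Category.assoc, Adjunction.homEquiv_naturality_right_symm, action_eq_symm,
    action_eq_symm]

lemma action_one (B : Ring Λ) :
    action τ B (MonObj.one (X := B.toLMod)) = G.counit ≫ MonObj.one (X := B.toLMod) := by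
  rw [action_eq_symm, one_coaction, Adjunction.homEquiv_naturality_right_symm]
  rfl

lemma action_mul (B : Ring Λ) {M N : LMod P} (m : M ⟶ B.toLMod) (n : N ⟶ B.toLMod) :
    action τ B ((m ⊗ₘ n) ≫ MonObj.mul (X := B.toLMod)) =
      G.coproduct M N ≫ (action τ B m ⊗ₘ action τ B n) ≫ MonObj.mul (X := B.toLMod) := by
  -- The oplax structure of the left adjoint is the mate of the lax structure of the right adjoint.
  have h : G.coproduct M N = (G.adj.homEquiv _ _).symm
      ((G.adj.unit.app M ⊗ₘ G.adj.unit.app N) ≫ Functor.LaxMonoidal.μ G.dual.toFunctor _ _) := rfl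
  rw [h, ← Adjunction.homEquiv_naturality_right_symm, action_eq_symm, Category.assoc,
    mul_coaction]
  congr 1
  rw [tensorHom_comp_tensorHom_assoc, ← unit_comp_map_action, ← unit_comp_map_action,
    ← tensorHom_comp_tensorHom, Category.assoc, Category.assoc, Functor.map_comp,
    ← Functor.LaxMonoidal.μ_natural_assoc]

lemma coaction_map_comp {G' : Cobialgebroid (LMod P)} (f : G' ⟶ G) (B : Ring Λ) :
    coaction ((freePlethory (LMod P)).map f ≫ τ) B = coaction τ B ≫ f.dual.app B.toLMod :=
  Category.assoc B.a.hom.hom (τ.unop.app B.A).hom.hom (f.dual.app B.toLMod) |>.symm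

end FormalActions

/-- A left adjoint of `M ↦ Hom(Γ, M)` extends `Γ`. -/
def Coextension.isoLeftAdjoint {P : Type v} [Category.{u} P] [HasCoproducts.{u} P]
    {Γ : P ⥤ LMod P} (D : Coextension Γ) {F : LMod P ⥤ LMod P} (adj : F ⊣ D.functor) :
    LMod.yoneda P ⋙ F ≅ Γ :=
  NatIso.ofComponents (fun A =>
    -- Both objects corepresent the maps from the representable of `A` to `D.functor.obj M`. The two
    -- maps transpose the respective universal elements.
    { hom := (adj.homEquiv _ _).symm (D.univ A)
      inv := D.homEquiv.symm (adj.unit.app ((LMod.yoneda P).obj A))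
      hom_inv_id := by
        refine (adj.homEquiv_naturality_right_symm _ _).symm.trans ?_
        rw [D.univ_comp_map, Equiv.apply_symm_apply, ← adj.homEquiv_id]
        exact Equiv.symm_apply_apply _ _
      inv_hom_id := by
        apply D.homEquiv.injective
        rw [D.homEquiv_comp, Equiv.apply_symm_apply]
        exact (adj.homEquiv_unit ..).symm.trans (Equiv.apply_symm_apply _ _) }) fun {A A'} g => by
    refine (adj.homEquiv_naturality_left_symm _ _).symm.trans
      (Eq.trans ?_ (adj.homEquiv_naturality_right_symm _ _))
    rw [D.map_comp_univ]

/-! ### The cobialgebroid of additive operations and its universal property. -/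

section Universal

variable {P : Type v} [Category.{u} P] [HasCoproducts.{u} P]
  [MonoidalCategory (LMod P)] [BraidedCategory (LMod P)] [Preadditive P] [IsMonoidalTheory P]

open Plethory LMod

namespace AdditiveOperations

variable {Λ : Plethory P} {Γ : AdditiveOperations Λ} (D : Coextension Γ.functor)
  [D.functor.IsRightAdjoint] (hP : IsBounded P) (hΓ : Γ.IsGood)

/-- A transformation out of the comonad of additive operations is monoidal if its effect on
`Λ`-rings is compatible with units and products. -/
lemma IsGood.isMonoidal {H : LMod P ⥤ LMod P} [H.IsRightAdjoint] [H.LaxMonoidal]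
    (θ : D.functor ⟶ H)
    (h_one : ∀ B : Ring Λ, MonObj.one ≫ coact D B ≫ θ.app B.toLMod =
      Functor.LaxMonoidal.ε H ≫ H.map (MonObj.one (X := B.toLMod)))
    (h_mul : ∀ B : Ring Λ, MonObj.mul ≫ coact D B ≫ θ.app B.toLMod =
      ((coact D B ≫ θ.app B.toLMod) ⊗ₘ (coact D B ≫ θ.app B.toLMod)) ≫
        Functor.LaxMonoidal.μ H B.toLMod B.toLMod ≫ H.map (MonObj.mul (X := B.toLMod))) :
    letI := hΓ.laxBraided D hP
    NatTrans.IsMonoidal θ :=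
  letI := hΓ.laxBraided D hP
  { unit := hΓ.map_hom_ext_unit fun B => by
      rw [← h_one, Category.assoc, ← θ.naturality]
      exact hΓ.laxUnit_comp_map_assoc D B _
    tensor := hΓ.tensor_ext hP (H := H)
      (θ := fun M N => hΓ.tensorator D hP M N ≫ θ.app (M ⊗ N))
      (θ' := fun M N => (θ.app M ⊗ₘ θ.app N) ≫ Functor.LaxMonoidal.μ H M N)
      (fun f g => by
        rw [tensorator_naturality_assoc, Category.assoc, ← θ.naturality])
      (fun f g => by
        rw [tensorHom_comp_tensorHom_assoc, θ.naturality, θ.naturality,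
          ← tensorHom_comp_tensorHom_assoc, Functor.LaxMonoidal.μ_natural, Category.assoc])
      (fun B => by
        rw [Category.assoc, ← θ.naturality, tensorator_comp_map_assoc, Category.assoc,
          tensorHom_comp_tensorHom_assoc, h_mul]) }

/-- The cobialgebroid of additive operations on the rings over a good plethory. -/
def IsGood.cobialgebroid : Cobialgebroid (LMod P) :=
  letI := hΓ.laxBraided D hP
  { dual := comonad D
    isRightAdjoint := inferInstanceAs D.functor.IsRightAdjoint
    laxBraided := hΓ.laxBraided D hP
    isMonoidal_counit := hΓ.isMonoidal D hP (counit D)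
      (fun B => by
        rw [coact_counit, Category.comp_id]
        exact (Category.id_comp _).symm)
      (fun B => by
        rw [coact_counit, Category.comp_id]
        simp)
    isMonoidal_comult := hΓ.isMonoidal D hP (comult D)
      (fun B => by
        -- Compatibility of `coact` with units is used twice, the second time under `D.functor`. The
        -- product below is treated in the same way.
        rw [coact_comult, ← laxUnit_comp_map_assoc, ← Functor.map_comp, ← laxUnit_comp_map,
          Functor.map_comp]
        exact (Category.assoc _ _ _).symm)
      (fun B => by
        have h : Functor.LaxMonoidal.μ (D.functor ⋙ D.functor) B.toLMod B.toLMod =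
          hΓ.tensorator D hP _ _ ≫ D.functor.map (hΓ.tensorator D hP _ _) := rfl
        rw [h, coact_comult, ← tensorator_comp_map_assoc D hP hΓ, ← Functor.map_comp,
          ← tensorator_comp_map D hP hΓ, Functor.comp_map, Functor.map_comp, Functor.map_comp,
          ← tensorHom_comp_tensorHom, Category.assoc, Category.assoc]
        rw [tensorator_naturality_assoc]) }

/-- The laws required of a coaction are exactly the equations by which the structure maps of the
cobialgebroid were prescribed. -/
lemma IsGood.exists_coaction_eq_coact :
    ∃ σ : (freePlethory (LMod P)).obj (hΓ.cobialgebroid D hP) ⟶ Λ.obj,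
      ∀ B : Ring Λ, coaction σ B = coact D B :=
  exists_hom_of_coaction (G := hΓ.cobialgebroid D hP) (coact D) (coact_naturality D) (coact_counit D)
    (coact_comult D) (fun B => (hΓ.laxUnit_comp_map D B).symm)
    (fun B => (hΓ.tensorator_comp_map D hP B).symm)

variable {D hP hΓ}
  {σ : (freePlethory (LMod P)).obj (hΓ.cobialgebroid D hP) ⟶ Λ.obj}
  (hσ : ∀ B : Ring Λ, coaction σ B = coact D B)

include hσ in
-- The condition on `f` says that `coact D B ≫ f.dual.app B.toLMod` is the coaction of `τ`. By the
-- universality of `coact` this has exactly one solution as a transformation, and its compatibility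
-- with the comonad and monoidal structures is again tested on $\Lambda$-rings.
lemma IsGood.existsUnique_hom {G : Cobialgebroid (LMod P)}
    (τ : (freePlethory (LMod P)).obj G ⟶ Λ.obj) :
    ∃! f : G ⟶ hΓ.cobialgebroid D hP, (freePlethory (LMod P)).map f ≫ σ = τ := by
  obtain ⟨θ, hθ⟩ := exists_natTrans D G.dual.toFunctor (coaction τ) (coaction_naturality τ)
  refine ⟨⟨(⟨θ, ?_, ?_⟩ : ComonadHom (comonad D) G.dual), ?_⟩, ?_, ?_⟩
  · refine congr_app (natTrans_ext (H := 𝟭 _) (θ := θ ≫ G.dual.ε) (θ' := counit D) fun B => ?_)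
    rw [NatTrans.comp_app, reassoc_of% hθ, coaction_counit, coact_counit]
  · refine congr_app (natTrans_ext (H := G.dual.toFunctor ⋙ G.dual.toFunctor)
      (θ := θ ≫ G.dual.δ) (θ' := comult D ≫ (θ ◫ θ)) fun B => ?_)
    have h := θ.naturality (coact D B)
    simp only [NatTrans.comp_app, NatTrans.hcomp_app]
    rw [reassoc_of% hθ, coaction_comult, coact_comult_assoc, reassoc_of% h, reassoc_of% hθ,
      ← Functor.map_comp, hθ]
  · exact hΓ.isMonoidal D hP θ (fun B => by rw [hθ, one_coaction])
      (fun B => by rw [hθ, mul_coaction])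
  · refine hom_ext_coaction fun B => ?_
    rw [coaction_map_comp, hσ]
    exact hθ B
  · intro f hf
    refine Cobialgebroid.Hom.ext (ComonadHom.ext (congrArg NatTrans.app ?_))
    refine natTrans_ext (H := G.dual.toFunctor) fun B => ?_
    refine Eq.trans ?_ (hθ B).symm
    rw [← hf, coaction_map_comp, hσ]
    rfl

include hσ in
/-- The universal property of the cobialgebroid of additive operations. -/
lemma IsGood.nonempty_isTerminal : Nonempty (IsTerminal (CostructuredArrow.mk σ)) := by
  choose f hf hf' using fun X : CostructuredArrow (freePlethory (LMod P)) Λ.obj =>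
    IsGood.existsUnique_hom hσ X.hom
  exact ⟨IsTerminal.ofUniqueHom (fun X => CostructuredArrow.homMk (f X) (hf X)) fun X m =>
    CostructuredArrow.hom_ext _ _ (hf' X m.left (CostructuredArrow.w m))⟩

include hσ in
-- Both sides transpose to `b ≫ coact D B`. This is why elements of `G` act as the operations that
-- they are.
lemma IsGood.isoLeftAdjoint_hom_comp_act {A : P} {B : Ring Λ}
    (b : (LMod.yoneda P).obj A ⟶ B.toLMod) :
    (D.isoLeftAdjoint (hΓ.cobialgebroid D hP).adj).hom.app A ≫ Γ.act b = action σ B b := by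
  rw [action_eq_symm, hσ]
  refine Eq.trans ?_ (congrArg _ (comp_coact D b).symm)
  exact (Adjunction.homEquiv_naturality_right_symm _ _ _).symm

include hσ in
lemma IsGood.isRestriction :
    IsRestriction Γ (hΓ.cobialgebroid D hP)
      (D.isoLeftAdjoint (hΓ.cobialgebroid D hP).adj) σ where
  action_eq x B b := by
    rw [← isoLeftAdjoint_hom_comp_act hσ, act_ofEl, LMod.app_comp, app_eval]
  unit := unit_comp_action σ
  mul := mul_comp_action σ
  counit := action_one σ
  coproduct := action_mul σ

end AdditiveOperations

end Universal

end Plethories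

end

open Plethories

theorem mainTheorem7 {P : Type v} [Category.{u} P] [Preadditive P] [HasCoproducts.{u} P]
    (hP : IsBounded P) [MonoidalCategory (LMod P)] [SymmetricCategory (LMod P)]
    [IsMonoidalTheory P] (Λ : Plethory P) (Γ : AdditiveOperations Λ) (hΓ : Γ.IsGood) :
    ∃ (G : Cobialgebroid (LMod P)) (e : LMod.yoneda P ⋙ G.functor ≅ Γ.functor)
      (σ : (freePlethory (LMod P)).obj G ⟶ Λ.obj),
      IsRestriction Γ G e σ ∧
        Nonempty (IsTerminal (CostructuredArrow.mk σ)) := by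
  have := hΓ.bimodule
  obtain ⟨D⟩ := nonempty_coextension hP Γ.functor
  have := D.isRightAdjoint hP
  obtain ⟨σ, hσ⟩ := hΓ.exists_coaction_eq_coact D hP
  exact ⟨_, _, σ, AdditiveOperations.IsGood.isRestriction hσ,
    AdditiveOperations.IsGood.nonempty_isTerminal hσ⟩
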